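/- **Conventions.** A *binomial domain* is an integral domain $R$ of characteristic zero such that $\binom{r}{k}=\frac{r(r-1)\cdots(r-k+1)}{k!}\in R$ for all $r\in R$, $k\in\mathbb N$. A *$\tau$-group* is a finitely generated torsion-free nilpotent group. A *Mal'cev basis* of a group $N$ is a tuple $(x_1,\dots,x_h)$ in $N$ such that, with $N_k=\langle x_k,\dots,x_h\rangle$, $N=N_1\ge N_2\ge\dots\ge N_{h+1}=1$ is a central series of $N$ and each $N_k/N_{k+1}$ is infinite cyclic, generated by $x_kN_{k+1}$. An *$R$-Mal'cev completion* of a $\tau$-group $N$ is a homomorphism $i:N\to N^R$ to a group $N^R$ with a power operation $N^R\times R\to N^R$, $(y,r)\mapsto y^r$, extending the integral powers, such that for some Mal'cev basis $(x_1,\dots,x_h)$ of $N$ the map $a\mapsto i(x)^a:=i(x_1)^{a_1}\cdots i(x_h)^{a_h}$ is a bijection $R^h\to N^R$, and there are tuples of polynomials $f,g$ with rational coefficients, taking values in $R$, with $i(x)^a\,i(x)^b=i(x)^{f(a,b)}$ and $(i(x)^a)^r=i(x)^{g(a,r)}$ for all $a,b\in R^h$, $r\in R$. An *$R$-morphism*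 between groups with such power operations is a group homomorphism $\varphi$ with $\varphi(y^r)=\varphi(y)^r$. A *virtually $\tau$-group* is a short exact sequence of groups $S:1\to N\to G\to F\to 1$ with $N$ a $\tau$-group and $F$ finite. An *$R$-Mal'cev completion* of $S$ is a morphism $(i,j,k):S\to S^R$ of short exact sequences, $S^R:1\to N^R\to G^R\to F^R\to 1$, such that $i:N\to N^R$ is an $R$-Mal'cev completion of $N$, $k$ is an isomorphism, and conjugation by each element of $G^R$ induces an $R$-automorphism of $N^R$. A morphism $(\alpha^R,\beta^R,\gamma^R):S_1^R\to S_2^R$ between completions is a morphism of short exact sequences whose first component $\alpha^R$ is an $R$-morphism. **Statement.** Let $R$ be a binomial domain. 1. (Existence) Every virtually $\tau$-group has an $R$-Mal'cev completion. 2. (Functoriality) Let $(i_1,j_1,k_1):S_1\to S_1^R$ and $(i_2,j_2,k_2):S_2\to S_2^R$ be $R$-Mal'cev completions of virtually $\tau$-groups $S_1$, $S_2$, and let $(\alpha,\beta,\gamma):S_1\to S_2$ be a morphism of short exact sequences. Then there is a unique morphism $(\alpha^R,\beta^R,\gamma^R):S_1^R\to S_2^R$ such that $(\alpha^Ri_1,\beta^Rj_1,\gamma^Rk_1)=(i_2\alpha,j_2\beta,k_2\gamma)$.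 3. (Uniqueness) If $(i_1,j_1,k_1):S\to S_1^R$ and $(i_2,j_2,k_2):S\to S_2^R$ are $R$-Mal'cev completions of a virtually $\tau$-group $S$, then there is a unique isomorphism $(\alpha^R,\beta^R,\gamma^R):S_1^R\to S_2^R$ such that $(\alpha^Ri_1,\beta^Rj_1,\gamma^Rk_1)=(i_2,j_2,k_2)$. -/

import Mathlib

universe u v uN uG uF a₁ a₂ a₃ b₁ b₂ b₃ c₁ c₂ c₃ d₁ d₂ d₃

namespace Malcev

/-- A `τ`-group: a finitely generated torsion-free nilpotent group. -/
structure IsTauGroup (N : Type u) [Group N] : Prop where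
  fg : Group.FG N
  nilpotent : Group.IsNilpotent N
  torsionFree : ∀ g : N, g ≠ 1 → ¬ IsOfFinOrder g

/-- A Mal'cev basis `x₁, …, x_h` of a group `N`: with `N_k = ⟨x_k, …, x_h⟩`, the chain
`N = N₁ ≥ N₂ ≥ ⋯ ≥ N_{h+1} = 1` is a central series of `N` whose factors `N_k / N_{k+1}`
are infinite cyclic, generated by the image of `x_k`. -/
structure IsMalcevBasis {N : Type u} [Group N] {h : ℕ} (x : Fin h → N) : Prop where
  closure_range : Subgroup.closure (Set.range x) = ⊤
  central : ∀ (k : Fin h) (g : N), x k * g * (x k)⁻¹ * g⁻¹ ∈ Subgroup.closure (x '' Set.Ioi k)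
  infinite : ∀ (k : Fin h) (n : ℤ), x k ^ n ∈ Subgroup.closure (x '' Set.Ioi k) → n = 0

/-- `f : R^ι → R` is a polynomial function with rational coefficients: `d • f` is given by a
polynomial with integer coefficients, for some positive integer `d`. -/
def IsRatPolynomial {R : Type v} [CommRing R] {ι : Type} (f : (ι → R) → R) : Prop :=
  ∃ (d : ℕ) (P : MvPolynomial ι ℤ), d ≠ 0 ∧ ∀ a : ι → R, (d : R) * f a = MvPolynomial.aeval a P

/-- The ordered product `x₁ ^ a₁ ⋯ x_h ^ a_h`, in a group `H` with exponents from `R`. -/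
def coordProd {R : Type v} {H : Type u} [Group H] [Pow H R] {h : ℕ}
    (x : Fin h → H) (a : Fin h → R) : H :=
  (List.ofFn fun k => x k ^ a k).prod

/-- `i : N →* N'`, where `N'` is a group with powers `y ^ r` for `r : R`, is an `R`-Mal'cev
completion of `N`: powers extend the integral ones, and for some Mal'cev basis
`x₁, …, x_h` of `N` every element of `N'` is uniquely of the form
`i(x₁) ^ a₁ ⋯ i(x_h) ^ a_h` with `a ∈ R^h`, the coordinates of a product being polynomials
over `ℚ` in the coordinates of the factors and the coordinates of `y ^ r` being polynomials over
`ℚ` in those of `y` and `r`. As `i` is a homomorphism, restricting to integral coordinates shows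
that these are the polynomials describing multiplication and powers of `N` itself in
the coordinates of `x`; so `N'` is P. Hall's group of formal products with exponents in `R`. -/
structure IsMalcevCompletion (R : Type v) [CommRing R] {N : Type*} {N' : Type*} [Group N]
    [Group N'] [Pow N' R] (i : N →* N') : Prop where
  pow_intCast : ∀ (y : N') (n : ℤ), y ^ (n : R) = y ^ n
  exists_basis : ∃ (h : ℕ) (x : Fin h → N), IsMalcevBasis x ∧
    Function.Bijective (fun a : Fin h → R => coordProd (fun k => i (x k)) a) ∧
    (∃ f : Fin h → (Fin h ⊕ Fin h → R) → R, (∀ k, IsRatPolynomial (f k)) ∧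
      ∀ a b : Fin h → R, coordProd (fun k => i (x k)) a * coordProd (fun k => i (x k)) b =
        coordProd (fun k => i (x k)) (fun k => f k (Sum.elim a b))) ∧
    (∃ g : Fin h → (Fin h ⊕ Unit → R) → R, (∀ k, IsRatPolynomial (g k)) ∧
      ∀ (a : Fin h → R) (r : R), (coordProd (fun k => i (x k)) a) ^ r =
        coordProd (fun k => i (x k)) (fun k => g k (Sum.elim a (fun _ => r))))

/-- Morphisms `(α, β, γ)` of short exact sequences of groups. -/
@[ext]
structure SESHom {N₁ G₁ F₁ N₂ G₂ F₂ : Type*} [Group N₁] [Group G₁] [Group F₁]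
    [Group N₂] [Group G₂] [Group F₂]
    (S₁ : GroupExtension N₁ G₁ F₁) (S₂ : GroupExtension N₂ G₂ F₂) where
  left : N₁ →* N₂
  mid : G₁ →* G₂
  right : F₁ →* F₂
  inl_comm : mid.comp S₁.inl = S₂.inl.comp left
  rightHom_comm : S₂.rightHom.comp mid = right.comp S₁.rightHom

/-- Composition of morphisms of short exact sequences. -/
def SESHom.comp {N₁ G₁ F₁ N₂ G₂ F₂ N₃ G₃ F₃ : Type*} [Group N₁] [Group G₁] [Group F₁]
    [Group N₂] [Group G₂] [Group F₂] [Group N₃] [Group G₃] [Group F₃]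
    {S₁ : GroupExtension N₁ G₁ F₁} {S₂ : GroupExtension N₂ G₂ F₂} {S₃ : GroupExtension N₃ G₃ F₃}
    (ψ : SESHom S₂ S₃) (φ : SESHom S₁ S₂) : SESHom S₁ S₃ where
  left := ψ.left.comp φ.left
  mid := ψ.mid.comp φ.mid
  right := ψ.right.comp φ.right
  inl_comm := by
    rw [MonoidHom.comp_assoc, φ.inl_comm, ← MonoidHom.comp_assoc, ψ.inl_comm,
      MonoidHom.comp_assoc]
  rightHom_comm := by
    rw [← MonoidHom.comp_assoc, ψ.rightHom_comm, MonoidHom.comp_assoc, φ.rightHom_comm,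
      MonoidHom.comp_assoc]

/-- A homomorphism between groups with powers by elements of `R` is an `R`-morphism if it
commutes with these powers. -/
def IsRMorphism (R : Type v) {H₁ H₂ : Type*} [Group H₁] [Group H₂] [Pow H₁ R] [Pow H₂ R]
    (f : H₁ →* H₂) : Prop :=
  ∀ (y : H₁) (r : R), f (y ^ r) = f y ^ r

/-- A virtually `τ`-group: a short exact sequence `1 → N → G → F → 1` with `N` a `τ`-group and
`F` finite. -/
def IsVirtuallyTau {N G F : Type*} [Group N] [Group G] [Group F] (_S : GroupExtension N G F) :
    Prop :=
  IsTauGroup N ∧ Finite F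

/-- `θ = (i, j, k) : S → S'` is an `R`-Mal'cev completion of the short exact sequence `S`: `i` is
an `R`-Mal'cev completion, `k` is an isomorphism, and the middle group of `S'` acts
on its kernel by `R`-automorphisms. -/
structure IsSESMalcevCompletion (R : Type v) [CommRing R]
    {N G F N' G' F' : Type*} [Group N] [Group G] [Group F]
    [Group N'] [Group G'] [Group F'] [Pow N' R]
    {S : GroupExtension N G F} {S' : GroupExtension N' G' F'} (θ : SESHom S S') : Prop where
  left : IsMalcevCompletion R θ.left
  right : Function.Bijective θ.right
  conj : ∀ g : G', IsRMorphism R (S'.conjAct g).toMonoidHom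

/-- A morphism of short exact sequences is an isomorphism if its three components are. -/
def SESHom.IsIso {N₁ G₁ F₁ N₂ G₂ F₂ : Type*} [Group N₁] [Group G₁] [Group F₁]
    [Group N₂] [Group G₂] [Group F₂]
    {S₁ : GroupExtension N₁ G₁ F₁} {S₂ : GroupExtension N₂ G₂ F₂} (φ : SESHom S₁ S₂) : Prop :=
  Function.Bijective φ.left ∧ Function.Bijective φ.mid ∧ Function.Bijective φ.right

end Malcev

/-!
A torsion-free finitely generated nilpotent group `N` has a Mal'cev basis `x₁, …, x_h`: its
subgroups are finitely generated (`fg_of_nilpotent`), the quotient by its centre is again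
torsion-free (`torsionFree_quotient_center`), and a basis of the quotient can be lifted and
followed by a `ℤ`-basis of the centre (`IsTauGroup.exists_isMalcevBasis`).

The coordinates of products and powers with respect to such a basis are integer-valued polynomials.
Call a map `ℤ^ι → N` polynomial if its coordinates are. By induction along the basis, the polynomial
maps are closed under pointwise products and under the discrete integration
`Φ(s) = F(0) F(1) ⋯ F(s - 1)` (`IsCentralList.isPolyClosed`). The crucial point of the induction is
that conjugation by `x ^ p(v)` preserves polynomial maps. It is enough to see that the orbits
`t ↦ x⁻ᵗ y xᵗ` of the basis elements `y` are polynomial, and they are, since the orbit of `y` is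
`y` times the integral of the orbit of `y⁻¹ x⁻¹ y x`, which involves only later basis elements. Powers are
integrals of constant maps, so Hall's polynomials exist (`IsMalcevBasis.exists_hallExpr`). They are
obtained as expressions in binomial coefficients (`BinomialExpr`), and can thus be evaluated in
every binomial ring `R`.

Since `R` is a domain of characteristic zero, a polynomial identity with rational coefficients that
holds at all integral points holds at all points of `R^n` (`IsRatPolynomial.funext`). All further
facts about completions of `N` are such identities: the group axioms on `R^h`
(`HallExpr.isMalcevCompletion`), the fact that inner automorphisms commute with powers
(`IsCompletionBasis.conj_pow`), and the fact that a homomorphism `α` extends by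
`x₁ ^ a₁ ⋯ x_h ^ a_h ↦ α(x₁) ^ a₁ ⋯ α(x_h) ^ a_h` to an `R`-morphism
(`IsCompletionBasis.exists_extension`).

For an extension `1 → N → G → F → 1`, the conjugation action of `G` extends to the completion `N'`
of `N`, and the middle group of the completion is the pushout of `G` and `N'` over `N`, realised
as a quotient of `N' ⋊ G` (`exists_pushout`). In every completion of the extension the middle group
is generated by its kernel and the image of `G`, which meet in the image of `N`; so an extension
of `α : N → N₂` to the completions, being compatible with conjugation, extends uniquely to
the middle groups (`SESHom.exists_extension`, `SESHom.ext_of_comp`). Uniqueness of the completion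
follows formally.
-/

universe w
namespace Malcev

section Groups

open Subgroup
open scoped commutatorElement

/-! ### Central series with cyclic factors -/

/-- The subgroup generated by the entries of a list. -/
def closureList {G : Type u} [Group G] (l : List G) : Subgroup G :=
  closure {y | y ∈ l}

/-- Each entry of the list is central modulo the subgroup generated by the later entries. -/
def IsCentralList {G : Type u} [Group G] : List G → Prop
  | [] => True
  | x :: l => (∀ g : G, x * g * x⁻¹ * g⁻¹ ∈ closureList l) ∧ IsCentralList l

/-- Each entry of the list has infinite order modulo the subgroup generated by the later entries. -/
def IsInfiniteList {G : Type u} [Group G] : List G → Prop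
  | [] => True
  | x :: l => (∀ n : ℤ, x ^ n ∈ closureList l → n = 0) ∧ IsInfiniteList l

section Lists

variable {G : Type u} [Group G]

@[simp] lemma closureList_nil : closureList ([] : List G) = ⊥ := by
  simp [closureList]

lemma closureList_cons (x : G) (l : List G) :
    closureList (x :: l) = zpowers x ⊔ closureList l := by
  rw [closureList, closureList, zpowers_eq_closure, ← Subgroup.closure_union]
  congr 1
  ext y
  simp

lemma mem_closureList {x : G} {l : List G} (h : x ∈ l) : x ∈ closureList l :=
  subset_closure h

lemma closureList_append (l l' : List G) :
    closureList (l ++ l') = closureList l ⊔ closureList l' := by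
  rw [closureList, closureList, closureList, ← Subgroup.closure_union]
  congr 1
  ext y
  simp

lemma closureList_le {l : List G} {H : Subgroup G} : closureList l ≤ H ↔ ∀ y ∈ l, y ∈ H :=
  closure_le H

lemma map_closureList {G' : Type v} [Group G'] (φ : G →* G') (l : List G) :
    (closureList l).map φ = closureList (l.map φ) := by
  rw [closureList, closureList, MonoidHom.map_closure]
  congr 1
  ext y
  simp

lemma IsCentralList.normal : ∀ {l : List G}, IsCentralList l → (closureList l).Normal
  | [], _ => by rw [closureList_nil]; infer_instance
  | x :: l, h => by
    have := IsCentralList.normal h.2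
    refine ⟨fun y hy g => ?_⟩
    have key : ∀ g, closureList (x :: l) ≤
        (closureList (x :: l)).comap (MulAut.conj g).toMonoidHom := by
      intro g
      rw [closureList_cons, sup_le_iff]
      constructor
      · rw [zpowers_le]
        have h1 := inv_mem (h.1 g)
        have h2 : (MulAut.conj g).toMonoidHom x = (x * g * x⁻¹ * g⁻¹)⁻¹ * x := by
          simp [mul_assoc]
        rw [mem_comap, h2]
        exact mul_mem (le_sup_right (a := zpowers x) h1)
          (le_sup_left (b := closureList l) (mem_zpowers x))
      · intro z hz
        exact le_sup_right (a := zpowers x) (this.conj_mem z hz g)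
    exact key g hy

lemma IsCentralList.mem_cons_iff {x : G} {l : List G} (h : IsCentralList l) {y : G} :
    y ∈ closureList (x :: l) ↔ ∃ n : ℤ, ∃ u ∈ closureList l, x ^ n * u = y := by
  have := h.normal
  rw [closureList_cons, mem_sup_of_normal_right]
  simp [mem_zpowers_iff]

/-- A group with a finite central series with cyclic factors satisfies the maximal condition on
subgroups. -/
lemma IsCentralList.fg_of_le : ∀ {l : List G}, IsCentralList l →
    ∀ H : Subgroup G, H ≤ closureList l → H.FG
  | [], _, H, hH => by
    rw [closureList_nil, le_bot_iff] at hH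
    rw [hH]
    exact ⟨∅, by simp⟩
  | x :: l, h, H, hH => by
    classical
    have hN := h.2.normal
    obtain ⟨S, hS⟩ := IsCentralList.fg_of_le h.2 (H ⊓ closureList l) inf_le_right
    let A : AddSubgroup ℤ :=
      { carrier := {n | x ^ n ∈ H ⊔ closureList l}
        zero_mem' := by simp
        add_mem' := fun {a b} ha hb => by
          simp only [Set.mem_ofPred_eq] at *
          rw [zpow_add]
          exact mul_mem ha hb
        neg_mem' := fun {a} ha => by
          simp only [Set.mem_ofPred_eq] at *
          rw [zpow_neg]
          exact inv_mem ha }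
    obtain ⟨d, hd⟩ := Int.subgroup_cyclic A
    have hdA : d ∈ A := by rw [hd]; exact AddSubgroup.subset_closure rfl
    -- `H` is generated by `H ⊓ closureList l` and an element `y` which agrees with `x ^ d` modulo
    -- `closureList l`, where `d` generates the group `A` of exponents occurring in `H`
    obtain ⟨y, hy, z, hz, hyz⟩ :=
      mem_sup_of_normal_right.1 (show x ^ d ∈ H ⊔ closureList l from hdA)
    refine ⟨insert y S, le_antisymm ?_ ?_⟩
    · rw [closure_le]
      intro w hw
      rcases Finset.mem_insert.1 (Finset.mem_coe.1 hw) with rfl | hw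
      · exact hy
      · exact (hS.le (subset_closure hw)).1
    · intro w hw
      obtain ⟨n, u, hu, rfl⟩ := h.2.mem_cons_iff.1 (hH hw)
      have hn : n ∈ A := by
        change x ^ n ∈ H ⊔ closureList l
        have : x ^ n = x ^ n * u * u⁻¹ := by group
        rw [this]
        exact mul_mem (le_sup_left (b := closureList l) hw) (le_sup_right (a := H) (inv_mem hu))
      rw [hd, AddSubgroup.mem_closure_singleton] at hn
      obtain ⟨m, rfl⟩ := hn
      have hym : (y ^ m)⁻¹ * (x ^ (m • d) * u) ∈ closureList l := by
        rw [← QuotientGroup.eq_one_iff]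
        have hxy : (QuotientGroup.mk x : G ⧸ closureList l) ^ d = QuotientGroup.mk y := by
          rw [← QuotientGroup.mk_zpow, ← hyz, QuotientGroup.mk_mul,
            (QuotientGroup.eq_one_iff z).2 hz, mul_one]
        rw [QuotientGroup.mk_mul, QuotientGroup.mk_mul, (QuotientGroup.eq_one_iff u).2 hu, mul_one,
          QuotientGroup.mk_inv, QuotientGroup.mk_zpow, QuotientGroup.mk_zpow, ← hxy, smul_eq_mul,
          mul_comm m d, zpow_mul, inv_mul_cancel]
      have h1 : (y ^ m)⁻¹ * (x ^ (m • d) * u) ∈ closure (S : Set G) := by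
        rw [hS]
        exact ⟨H.mul_mem (H.inv_mem (H.zpow_mem hy m)) hw, hym⟩
      have h2 : x ^ (m • d) * u = y ^ m * ((y ^ m)⁻¹ * (x ^ (m • d) * u)) := by group
      rw [h2]
      exact mul_mem (zpow_mem (K := Subgroup.closure _) (subset_closure (by simp)) m)
        (closure_mono (by simp) h1)

/-- Elements which are central modulo the subgroup generated by a central list can be put in front
of it, in any order. -/
lemma IsCentralList.append {l : List G} (h : IsCentralList l) :
    ∀ {s : List G}, (∀ x ∈ s, ∀ g, x * g * x⁻¹ * g⁻¹ ∈ closureList l) → IsCentralList (s ++ l)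
  | [], _ => h
  | x :: s, hs => by
    refine ⟨fun g => ?_, h.append fun y hy => hs y (List.mem_cons_of_mem _ hy)⟩
    change _ ∈ closureList (s ++ l)
    rw [closureList_append]
    exact le_sup_right (a := closureList s) (hs x List.mem_cons_self g)

end Lists

section FG

variable {G : Type u} [Group G]

/-- Each term of the lower central series of a finitely generated group is finitely generated
modulo the next one: it is generated by commutators of generators. -/
lemma exists_list_lowerCentralSeries [hfg : Group.FG G] (n : ℕ) :
    ∃ s : List G, closureList s ⊔ (⊤ : Subgroup G).lowerCentralSeries (n + 1) =
      (⊤ : Subgroup G).lowerCentralSeries n := by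
  set L := (⊤ : Subgroup G).lowerCentralSeries with hL
  obtain ⟨T, hT⟩ := hfg.out
  have hanti := (⊤ : Subgroup G).lowerCentralSeries_antitone
  have hTl : closureList T.toList = ⊤ := by
    rw [← hT, closureList]; congr 1; ext; simp
  have hcomm : ∀ m, ∀ a ∈ L m, ∀ g : G, ⁅a, g⁆ ∈ L (m + 1) := fun m a ha g => by
    rw [hL, Subgroup.lowerCentralSeries_succ]
    exact commutator_mem_commutator ha (mem_top g)
  induction n with
  | zero =>
    refine ⟨T.toList, ?_⟩
    rw [hTl, top_sup_eq, hL, Subgroup.lowerCentralSeries_zero]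
  | succ n ih =>
    obtain ⟨s, hs⟩ := ih
    let s' : List G := (s ×ˢ T.toList).map fun p => ⁅p.1, p.2⁆
    have hs'L : closureList s' ≤ L (n + 1) := by
      rw [closureList_le]
      intro y hy
      obtain ⟨p, hp, rfl⟩ := List.mem_map.1 hy
      refine hcomm n _ ?_ _
      rw [← hs]
      exact le_sup_left (b := L (n + 1)) (mem_closureList (List.mem_product.1 hp).1)
    refine ⟨s', le_antisymm (sup_le hs'L (hanti (Nat.le_succ _))) ?_⟩
    set H := closureList s' ⊔ L (n + 2) with hH
    have hHL : H ≤ L (n + 1) := sup_le hs'L (hanti (Nat.le_succ _))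
    have hHn : H.Normal := ⟨fun y hy g => by
      have h1 : ⁅g, y⁆ ∈ H := by
        rw [← commutatorElement_inv]
        exact inv_mem (le_sup_right (a := closureList s') (hcomm (n + 1) y (hHL hy) g))
      have h2 : g * y * g⁻¹ = ⁅g, y⁆ * y := by simp [commutatorElement_def]
      rw [h2]
      exact mul_mem h1 hy⟩
    -- modulo `H` the subgroup `L n` is central
    have hcen : L n ≤ (center (G ⧸ H)).comap (QuotientGroup.mk' H) := by
      have hmk : ∀ a g : G, ⁅a, g⁆ ∈ H →
          QuotientGroup.mk' H g * QuotientGroup.mk' H a =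
            QuotientGroup.mk' H a * QuotientGroup.mk' H g := by
        intro a g hag
        have := (QuotientGroup.eq_one_iff _).2 hag
        have h3 : ⁅QuotientGroup.mk' H a, QuotientGroup.mk' H g⁆ = 1 := by
          rw [← map_commutatorElement]; exact this
        exact (commutatorElement_eq_one_iff_mul_comm.1 h3).symm
      rw [← hs, sup_le_iff, closureList_le]
      constructor
      · intro a ha
        rw [mem_comap, mem_center_iff]
        intro q
        obtain ⟨g, rfl⟩ := QuotientGroup.mk'_surjective H q
        have hg : g ∈ closureList T.toList := by rw [hTl]; exact mem_top g
        have : closureList T.toList ≤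
            (centralizer {QuotientGroup.mk' H a}).comap (QuotientGroup.mk' H) := by
          rw [closureList_le]
          intro t ht
          rw [mem_comap, mem_centralizer_singleton_iff]
          refine hmk a t (le_sup_left (b := L (n + 2)) (mem_closureList ?_))
          exact List.mem_map.2 ⟨(a, t), List.mem_product.2 ⟨ha, ht⟩, rfl⟩
        exact mem_centralizer_singleton_iff.1 (mem_comap.1 (this hg))
      · intro a ha
        rw [mem_comap, mem_center_iff]
        intro q
        obtain ⟨g, rfl⟩ := QuotientGroup.mk'_surjective H q
        exact hmk a g (le_sup_right (a := closureList s') (hcomm (n + 1) a ha g))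
    rw [hL, Subgroup.lowerCentralSeries_succ, commutator_le]
    intro a ha g _
    rw [← QuotientGroup.eq_one_iff]
    have := mem_center_iff.1 (mem_comap.1 (hcen ha)) (QuotientGroup.mk' H g)
    change QuotientGroup.mk' H ⁅a, g⁆ = 1
    rw [map_commutatorElement, commutatorElement_eq_one_iff_mul_comm]
    exact this.symm

lemma exists_isCentralList [Group.FG G] [Group.IsNilpotent G] :
    ∃ l : List G, IsCentralList l ∧ closureList l = ⊤ := by
  obtain ⟨n, hn⟩ :=
    Subgroup.nilpotent_iff_lowerCentralSeries.1 (inferInstance : Group.IsNilpotent G)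
  have key : ∀ k, k ≤ n → ∃ l : List G, IsCentralList l ∧
      closureList l = (⊤ : Subgroup G).lowerCentralSeries (n - k) := by
    intro k
    induction k with
    | zero => exact fun _ => ⟨[], trivial, by simp [hn]⟩
    | succ k ih =>
      intro hk
      obtain ⟨l, hl, hl'⟩ := ih (by omega)
      obtain ⟨s, hs⟩ := exists_list_lowerCentralSeries (G := G) (n - (k + 1))
      have hnk : n - (k + 1) + 1 = n - k := by omega
      rw [hnk] at hs
      refine ⟨s ++ l, hl.append fun x hx g => ?_, ?_⟩
      · rw [hl', ← hnk, Subgroup.lowerCentralSeries_succ]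
        refine commutator_mem_commutator ?_ (mem_top g)
        rw [← hs]
        exact le_sup_left (b := (⊤ : Subgroup G).lowerCentralSeries (n - k)) (mem_closureList hx)
      · rw [closureList_append, hl', hs]
  obtain ⟨l, hl, hl'⟩ := key n le_rfl
  exact ⟨l, hl, by simpa using hl'⟩

/-- Every subgroup of a finitely generated nilpotent group is finitely generated. -/
lemma fg_of_nilpotent [Group.FG G] [Group.IsNilpotent G] (H : Subgroup G) : H.FG := by
  obtain ⟨l, hl, hl'⟩ := exists_isCentralList (G := G)
  exact hl.fg_of_le H (by rw [hl']; exact le_top)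

end FG

/-! ### Existence of Mal'cev bases -/

section TorsionFree

variable {G : Type u} [Group G]

lemma commutatorElement_pow_eq_one {g h : G} {n : ℕ} (h1 : Commute ⁅g, h⁆ g)
    (h2 : Commute (g ^ n) h) : ⁅g, h⁆ ^ n = 1 := by
  have h3 : h * g * h⁻¹ = ⁅g, h⁆⁻¹ * g := by simp [commutatorElement_def, mul_assoc]
  have h4 : h * g ^ n * h⁻¹ = g ^ n := by rw [← h2.eq, mul_inv_cancel_right]
  rw [← conj_pow, h3, h1.inv_left.mul_pow, mul_eq_right, inv_pow, inv_eq_one] at h4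
  exact h4

/-- In a torsion-free group the factors of the upper central series are torsion-free: modulo
`Z_i` the commutator of `g ∈ Z_{i+2}` with `h` is a homomorphism in `g`, with values in
`Z_{i+1} / Z_i`. -/
lemma mem_upperCentralSeries_of_pow_mem (ht : ∀ g : G, g ≠ 1 → ¬ IsOfFinOrder g) {n : ℕ}
    (hn : n ≠ 0) (i : ℕ) : ∀ g ∈ Subgroup.upperCentralSeries G (i + 1),
      g ^ n ∈ Subgroup.upperCentralSeries G i → g ∈ Subgroup.upperCentralSeries G i := by
  induction i with
  | zero =>
    intro g _ hgn
    rw [Subgroup.upperCentralSeries_zero, mem_bot] at hgn ⊢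
    by_contra hg
    exact ht g hg (isOfFinOrder_iff_pow_eq_one.2 ⟨n, Nat.pos_of_ne_zero hn, hgn⟩)
  | succ i ih =>
    intro g hg hgn
    rw [Subgroup.mem_upperCentralSeries_succ_iff]
    intro h
    have hc := Subgroup.mem_upperCentralSeries_succ_iff.1 hg h
    refine ih _ hc ?_
    set π := QuotientGroup.mk' (Subgroup.upperCentralSeries G i)
    have hπ : ∀ a b, ⁅a, b⁆ ∈ Subgroup.upperCentralSeries G i → Commute (π a) (π b) := by
      intro a b hab
      rw [commute_iff_eq, ← commutatorElement_eq_one_iff_mul_comm, ← map_commutatorElement]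
      exact (QuotientGroup.eq_one_iff _).2 hab
    rw [← QuotientGroup.eq_one_iff]
    change π _ = 1
    rw [map_pow, map_commutatorElement]
    refine commutatorElement_pow_eq_one ?_ ?_
    · rw [← map_commutatorElement]
      exact hπ _ _ (Subgroup.mem_upperCentralSeries_succ_iff.1 hc g)
    · rw [← map_pow]
      exact hπ _ _ (Subgroup.mem_upperCentralSeries_succ_iff.1 hgn h)

lemma torsionFree_quotient_center [hnil : Group.IsNilpotent G]
    (ht : ∀ g : G, g ≠ 1 → ¬ IsOfFinOrder g) :
    ∀ q : G ⧸ center G, q ≠ 1 → ¬ IsOfFinOrder q := by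
  intro q hq hfin
  obtain ⟨g, rfl⟩ := QuotientGroup.mk'_surjective _ q
  obtain ⟨n, hn, hgn⟩ := isOfFinOrder_iff_pow_eq_one.1 hfin
  apply hq
  change QuotientGroup.mk g = 1
  rw [← map_pow] at hgn
  have hgn := (QuotientGroup.eq_one_iff _).1 hgn
  rw [QuotientGroup.eq_one_iff, ← Subgroup.upperCentralSeries_one]
  rw [← Subgroup.upperCentralSeries_one] at hgn
  obtain ⟨c, hc⟩ := hnil.nilpotent
  have key : ∀ i, g ∈ Subgroup.upperCentralSeries G (i + 1) →
      g ∈ Subgroup.upperCentralSeries G 1 := by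
    intro i
    induction i with
    | zero => exact id
    | succ i ih =>
      intro hg
      exact ih (mem_upperCentralSeries_of_pow_mem ht hn.ne' _ g hg
        (Subgroup.upperCentralSeries_mono G (by omega) hgn))
  exact key c (Subgroup.upperCentralSeries_mono G (Nat.le_succ c) (by rw [hc]; exact mem_top g))

end TorsionFree

section Basis

lemma closure_image_Ioi_zero {N : Type u} [Group N] {h : ℕ} (x : Fin (h + 1) → N) :
    closure (x '' Set.Ioi 0) = closureList (List.ofFn (Fin.tail x)) := by
  rw [closureList]
  congr 1
  ext y
  simp only [Set.mem_image, Set.mem_Ioi, Set.mem_ofPred_eq, List.mem_ofFn, Fin.tail]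
  constructor
  · rintro ⟨k, hk, rfl⟩
    exact ⟨k.pred hk.ne', by simp⟩
  · rintro ⟨k, rfl⟩
    exact ⟨k.succ, Fin.succ_pos k, rfl⟩

lemma image_Ioi_succ {N : Type u} {h : ℕ} (x : Fin (h + 1) → N) (k : Fin h) :
    x '' Set.Ioi k.succ = Fin.tail x '' Set.Ioi k := by
  ext y
  simp only [Set.mem_image, Set.mem_Ioi, Fin.tail]
  constructor
  · rintro ⟨j, hj, rfl⟩
    refine ⟨j.pred ((Fin.succ_pos k).trans hj).ne', ?_, by simp⟩
    rwa [Fin.lt_pred_iff]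
  · rintro ⟨j, hj, rfl⟩
    exact ⟨j.succ, Fin.succ_lt_succ_iff.2 hj, rfl⟩

lemma isCentralList_ofFn_iff {N : Type u} [Group N] {h : ℕ} (x : Fin h → N) :
    IsCentralList (List.ofFn x) ↔
      ∀ (k : Fin h) (g : N), x k * g * (x k)⁻¹ * g⁻¹ ∈ closure (x '' Set.Ioi k) := by
  induction h with
  | zero => simp [IsCentralList]
  | succ h ih =>
    rw [List.ofFn_succ, Fin.forall_fin_succ, closure_image_Ioi_zero]
    simp only [image_Ioi_succ]
    exact and_congr Iff.rfl (ih (Fin.tail x))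

lemma isInfiniteList_ofFn_iff {N : Type u} [Group N] {h : ℕ} (x : Fin h → N) :
    IsInfiniteList (List.ofFn x) ↔
      ∀ (k : Fin h) (n : ℤ), x k ^ n ∈ closure (x '' Set.Ioi k) → n = 0 := by
  induction h with
  | zero => simp [IsInfiniteList]
  | succ h ih =>
    rw [List.ofFn_succ, Fin.forall_fin_succ, closure_image_Ioi_zero]
    simp only [image_Ioi_succ]
    exact and_congr Iff.rfl (ih (Fin.tail x))

/-- The list form of the notion of a Mal'cev basis. -/
lemma isMalcevBasis_iff {N : Type u} [Group N] {h : ℕ} (x : Fin h → N) :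
    IsMalcevBasis x ↔ closureList (List.ofFn x) = ⊤ ∧ IsCentralList (List.ofFn x) ∧
      IsInfiniteList (List.ofFn x) := by
  have h1 : closureList (List.ofFn x) = closure (Set.range x) := by
    rw [closureList]
    congr 1
    ext y
    simp [List.mem_ofFn]
  rw [isCentralList_ofFn_iff, isInfiniteList_ofFn_iff, h1]
  exact ⟨fun hx => ⟨hx.1, hx.2, hx.3⟩, fun hx => ⟨hx.1, hx.2.1, hx.2.2⟩⟩

lemma exists_isMalcevBasis_of_comm (A : Type u) [instA : Group A] [Group.FG A]
    (hcomm : ∀ a b : A, a * b = b * a)    (ht : ∀ g : A, g ≠ 1 → ¬ IsOfFinOrder g) :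
    ∃ (h : ℕ) (x : Fin h → A), IsMalcevBasis x := by
  let _ : CommGroup A := { instA with mul_comm := hcomm }
  have : Module.Finite ℤ (Additive A) := Module.Finite.iff_addGroup_fg.2 inferInstance
  have : IsMulTorsionFree A := isMulTorsionFree_iff_not_isOfFinOrder.2 fun g hg => ht g hg
  let b := Module.finBasis ℤ (Additive A)
  refine ⟨_, fun k => (b k).toMul, ⟨?_, fun k g => by simp, fun k n hn => ?_⟩⟩
  · rw [eq_top_iff]
    intro a _
    have h1 : a = ∏ k, (b k).toMul ^ (b.repr (Additive.ofMul a) k) := by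
      have := congrArg Additive.toMul (b.sum_repr (Additive.ofMul a))
      rw [toMul_ofMul, toMul_sum] at this
      simpa using this.symm
    rw [h1]
    exact prod_mem fun k _ => zpow_mem (Subgroup.subset_closure (Set.mem_range_self k)) _
  · have h2 : closure ((fun k => (b k).toMul) '' Set.Ioi k) ≤
        (AddMonoidHom.toMultiplicativeRight (b.coord k).toAddMonoidHom).ker := by
      rw [closure_le]
      rintro _ ⟨j, hj, rfl⟩
      simp [MonoidHom.mem_ker, (Set.mem_Ioi.1 hj).ne']
    have h3 := h2 hn
    rw [MonoidHom.mem_ker, map_zpow] at h3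
    simpa using congrArg Multiplicative.toAdd h3

variable {G : Type u} [Group G]

lemma IsInfiniteList.map {G' : Type v} [Group G'] {φ : G →* G'} (hφ : Function.Injective φ) :
    ∀ {l : List G}, IsInfiniteList l → IsInfiniteList (l.map φ)
  | [], _ => trivial
  | x :: l, h => by
    refine ⟨fun n hn => h.1 n ?_, IsInfiniteList.map hφ h.2⟩
    change _ ∈ closureList (l.map φ) at hn
    rw [← map_closureList, ← map_zpow] at hn
    exact (mem_map_iff_mem hφ).1 hn

lemma isCentralList_of_subset_center : ∀ {l : List G}, (∀ x ∈ l, x ∈ center G) → IsCentralList l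
  | [], _ => trivial
  | x :: l, h => by
    refine ⟨fun g => ?_, isCentralList_of_subset_center fun y hy => h y (List.mem_cons_of_mem _ hy)⟩
    have := mem_center_iff.1 (h x List.mem_cons_self) g
    rw [← this, mul_inv_cancel_right, mul_inv_cancel]
    exact one_mem _

/-- Representatives of a list in `G ⧸ K`, followed by a list generating `K`, generate the preimage
of the subgroup generated by the former list. -/
lemma closureList_lift (K : Subgroup G) [K.Normal] {z : List G} (hz : closureList z = K)
    (l : List (G ⧸ K)) :
    closureList (l.map Quotient.out ++ z) = (closureList l).comap (QuotientGroup.mk' K) := by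
  have h1 : l = (l.map Quotient.out).map (QuotientGroup.mk' K) := by
    rw [List.map_map]
    conv_lhs => rw [← List.map_id l]
    refine List.map_congr_left fun q _ => ?_
    exact (Quotient.out_eq q).symm
  conv_rhs => rw [h1]
  rw [← map_closureList, comap_map_eq, QuotientGroup.ker_mk', closureList_append, hz]

lemma IsCentralList.lift (K : Subgroup G) [K.Normal] {z : List G} (hz : closureList z = K)
    (hz' : IsCentralList z) : ∀ {l : List (G ⧸ K)}, IsCentralList l →
      IsCentralList (l.map Quotient.out ++ z)
  | [], _ => hz'
  | q :: l, h => by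
    refine ⟨fun g => ?_, IsCentralList.lift K hz hz' h.2⟩
    change _ ∈ closureList (l.map Quotient.out ++ z)
    rw [closureList_lift K hz, mem_comap]
    have h1 := h.1 (QuotientGroup.mk' K g)
    have h2 : QuotientGroup.mk' K q.out = q := Quotient.out_eq q
    simpa [h2] using h1

lemma IsInfiniteList.lift (K : Subgroup G) [K.Normal] {z : List G} (hz : closureList z = K)
    (hz' : IsInfiniteList z) : ∀ {l : List (G ⧸ K)}, IsInfiniteList l →
      IsInfiniteList (l.map Quotient.out ++ z)
  | [], _ => hz'
  | q :: l, h => by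
    refine ⟨fun n hn => h.1 n ?_, IsInfiniteList.lift K hz hz' h.2⟩
    change _ ∈ closureList (l.map Quotient.out ++ z) at hn
    rw [closureList_lift K hz, mem_comap, map_zpow] at hn
    have h2 : QuotientGroup.mk' K q.out = q := Quotient.out_eq q
    rwa [h2] at hn

theorem IsTauGroup.exists_isMalcevBasis {N : Type u} [Group N] (hN : IsTauGroup N) :
    ∃ (h : ℕ) (x : Fin h → N), IsMalcevBasis x := by
  have := hN.fg
  have := hN.nilpotent
  have key : Group.FG N → (∀ g : N, g ≠ 1 → ¬ IsOfFinOrder g) →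
      ∃ l : List N, closureList l = ⊤ ∧ IsCentralList l ∧ IsInfiniteList l := by
    refine Group.nilpotent_center_quotient_ind
      (P := fun N _ _ => Group.FG N → (∀ g : N, g ≠ 1 → ¬ IsOfFinOrder g) →
      ∃ l : List N, closureList l = ⊤ ∧ IsCentralList l ∧ IsInfiniteList l) N ?_ ?_
    · intro G _ _ _ _
      exact ⟨[], Subsingleton.elim _ _, trivial, trivial⟩
    · intro G _ _ ih hfg ht
      obtain ⟨l, hl, hlc, hli⟩ := ih inferInstance (torsionFree_quotient_center ht)
      have : Group.FG (center G) := (Group.fg_iff_subgroup_fg _).2 (fg_of_nilpotent _)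
      obtain ⟨h, x, hx⟩ := exists_isMalcevBasis_of_comm (center G)
        (fun a b => Subtype.ext (mem_center_iff.1 b.2 a)) fun g hg hfin =>
        ht g (by simpa using hg) (Submonoid.isOfFinOrder_coe.2 hfin)
      obtain ⟨hx1, -, hx3⟩ := (isMalcevBasis_iff x).1 hx
      set z := (List.ofFn x).map (center G).subtype with hz
      have hzc : closureList z = center G := by
        rw [hz, ← map_closureList, hx1, ← MonoidHom.range_eq_map, range_subtype]
      refine ⟨l.map Quotient.out ++ z, ?_, ?_, ?_⟩
      · rw [closureList_lift _ hzc, hl, comap_top]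
      · exact IsCentralList.lift _ hzc
          (isCentralList_of_subset_center fun y hy => hzc.le (mem_closureList hy)) hlc
      · exact IsInfiniteList.lift _ hzc (hx3.map (subtype_injective _)) hli
  obtain ⟨l, hl⟩ := key hN.fg hN.torsionFree
  refine ⟨l.length, l.get, (isMalcevBasis_iff _).2 ?_⟩
  rwa [List.ofFn_get]

end Basis

end Groups

/-! ### Integer-valued polynomials -/

section RatPolynomial

variable {R : Type v} [CommRing R] {ι κ : Type}

lemma isRatPolynomial_aeval (P : MvPolynomial ι ℤ) :
    IsRatPolynomial fun v : ι → R => MvPolynomial.aeval v P :=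
  ⟨1, P, one_ne_zero, fun v => by simp⟩

lemma isRatPolynomial_coord (i : ι) : IsRatPolynomial fun v : ι → R => v i := by
  simpa using isRatPolynomial_aeval (R := R) (MvPolynomial.X i)

lemma isRatPolynomial_intCast (n : ℤ) : IsRatPolynomial fun _ : ι → R => (n : R) := by
  simpa using isRatPolynomial_aeval (R := R) (ι := ι) (MvPolynomial.C n)

lemma IsRatPolynomial.add {f g : (ι → R) → R} (hf : IsRatPolynomial f) (hg : IsRatPolynomial g) :
    IsRatPolynomial fun v => f v + g v := by
  obtain ⟨d, P, hd, hP⟩ := hf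
  obtain ⟨e, Q, he, hQ⟩ := hg
  refine ⟨d * e, (e : MvPolynomial ι ℤ) * P + (d : MvPolynomial ι ℤ) * Q, mul_ne_zero hd he,
    fun v => ?_⟩
  rw [map_add, map_mul, map_mul, map_natCast, map_natCast, ← hP, ← hQ]
  push_cast
  ring

lemma IsRatPolynomial.mul {f g : (ι → R) → R} (hf : IsRatPolynomial f) (hg : IsRatPolynomial g) :
    IsRatPolynomial fun v => f v * g v := by
  obtain ⟨d, P, hd, hP⟩ := hf
  obtain ⟨e, Q, he, hQ⟩ := hg
  refine ⟨d * e, P * Q, mul_ne_zero hd he, fun v => ?_⟩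
  rw [map_mul, ← hP, ← hQ]
  push_cast
  ring

lemma IsRatPolynomial.of_natCast_mul {f : (ι → R) → R} {d : ℕ} (hd : d ≠ 0)
    (h : IsRatPolynomial fun v => (d : R) * f v) : IsRatPolynomial f := by
  obtain ⟨e, P, he, hP⟩ := h
  exact ⟨e * d, P, mul_ne_zero he hd, fun v => by rw [← hP]; push_cast; ring⟩

/-- Rational polynomials can be substituted into each other: after clearing the denominator of `f`,
only an integral polynomial in the `q i` is left. -/
lemma IsRatPolynomial.comp {f : (ι → R) → R} (hf : IsRatPolynomial f) {q : ι → (κ → R) → R}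
    (hq : ∀ i, IsRatPolynomial (q i)) : IsRatPolynomial fun v => f fun i => q i v := by
  obtain ⟨d, P, hd, hP⟩ := hf
  refine IsRatPolynomial.of_natCast_mul hd ?_
  simp only [hP]
  clear hP
  induction P using MvPolynomial.induction_on with
  | C n => simpa using isRatPolynomial_intCast n
  | add P Q hP hQ => simpa using hP.add hQ
  | mul_X P i hP => simpa using hP.mul (hq i)

lemma IsRatPolynomial.choose [BinomialRing R] {f : (ι → R) → R} (hf : IsRatPolynomial f) (k : ℕ) :
    IsRatPolynomial fun v => Ring.choose (f v) k := by
  refine IsRatPolynomial.of_natCast_mul (Nat.factorial_ne_zero k) ?_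
  simp only [← nsmul_eq_mul, ← Ring.descPochhammer_eq_factorial_smul_choose,
    ← Polynomial.aeval_eq_smeval]
  induction descPochhammer ℤ k using Polynomial.induction_on' with
  | add P Q hP hQ => simpa using hP.add hQ
  | monomial n a =>
    have h1 : ∀ n : ℕ, IsRatPolynomial fun v => f v ^ n := fun n => by
      induction n with
      | zero => simpa using isRatPolynomial_intCast (R := R) (ι := ι) 1
      | succ n ih => simpa [pow_succ] using ih.mul hf
    simpa using (isRatPolynomial_intCast (R := R) (ι := ι) a).mul (h1 n)

/-- Polynomial identities with rational coefficients may be checked on integral points. -/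
lemma IsRatPolynomial.funext [IsDomain R] [CharZero R] {f g : (ι → R) → R}
    (hf : IsRatPolynomial f) (hg : IsRatPolynomial g)
    (h : ∀ v : ι → ℤ, f (fun i => (v i : R)) = g fun i => (v i : R)) (v : ι → R) :
    f v = g v := by
  obtain ⟨d, P, hd, hP⟩ := hf
  obtain ⟨e, Q, he, hQ⟩ := hg
  have key : (e : MvPolynomial ι ℤ) * P = (d : MvPolynomial ι ℤ) * Q := by
    refine MvPolynomial.funext fun w => ?_
    apply Int.cast_injective (α := R)
    have hcast : ∀ T : MvPolynomial ι ℤ, ((MvPolynomial.eval w T : ℤ) : R) =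
        MvPolynomial.aeval (fun i => (w i : R)) T := fun T => by
      have := MvPolynomial.aeval_algebraMap_apply R w T
      simpa [MvPolynomial.aeval_eq_eval, Function.comp_def] using this.symm
    rw [hcast, hcast, map_mul, map_mul, map_natCast, map_natCast, ← hP, ← hQ, h w]
    ring
  have h1 := congrArg (MvPolynomial.aeval v) key
  rw [map_mul, map_mul, map_natCast, map_natCast, ← hP, ← hQ] at h1
  have hde : (d : R) * e ≠ 0 := mul_ne_zero (Nat.cast_ne_zero.2 hd) (Nat.cast_ne_zero.2 he)
  refine mul_left_cancel₀ hde ?_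
  linear_combination h1

end RatPolynomial

/-- Formal expressions in variables indexed by `ι`, built from integer constants, sums, products
and binomial coefficients. They can be evaluated in every binomial ring, and stand for
the integer-valued polynomials. -/
inductive BinomialExpr (ι : Type) : Type
  | var (i : ι)
  | const (n : ℤ)
  | add (e e' : BinomialExpr ι)
  | mul (e e' : BinomialExpr ι)
  | choose (e : BinomialExpr ι) (k : ℕ)

namespace BinomialExpr

variable {R : Type v} [CommRing R] [BinomialRing R] {ι κ : Type}

/-- The value of an expression at a point with coordinates in a binomial ring. -/
def eval (v : ι → R) : BinomialExpr ι → R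
  | var i => v i
  | const n => n
  | add e e' => e.eval v + e'.eval v
  | mul e e' => e.eval v * e'.eval v
  | choose e k => Ring.choose (e.eval v) k

/-- Substitution of expressions for the variables. -/
def subst (q : ι → BinomialExpr κ) : BinomialExpr ι → BinomialExpr κ
  | var i => q i
  | const n => const n
  | add e e' => add (e.subst q) (e'.subst q)
  | mul e e' => mul (e.subst q) (e'.subst q)
  | choose e k => choose (e.subst q) k

lemma eval_subst (q : ι → BinomialExpr κ) (e : BinomialExpr ι) (v : κ → R) :
    (e.subst q).eval v = e.eval fun i => (q i).eval v := by
  induction e <;> simp_all [eval, subst]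

lemma isRatPolynomial_eval (e : BinomialExpr ι) : IsRatPolynomial fun v : ι → R => e.eval v := by
  induction e with
  | var i => exact isRatPolynomial_coord i
  | const n => exact isRatPolynomial_intCast n
  | add e e' h h' => exact h.add h'
  | mul e e' h h' => exact h.mul h'
  | choose e k h => exact h.choose k

lemma eval_intCast (e : BinomialExpr ι) (v : ι → ℤ) :
    e.eval (fun i => (v i : R)) = (e.eval v : ℤ) := by
  induction e with
  | choose e k h =>
    have := Ring.map_multichoose (Int.castRingHom R) (e.eval v - k + 1) k
    simp only [eval, h, Ring.choose]
    simpa using this.symm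
  | _ => simp_all [eval]

end BinomialExpr

/-- A function of several integers is given by an expression built from binomial coefficients,
that is, it is an integer-valued polynomial. -/
def IsBinomial {ι : Type} (f : (ι → ℤ) → ℤ) : Prop :=
  ∃ e : BinomialExpr ι, ∀ v, f v = e.eval v

namespace IsBinomial

variable {ι κ : Type} {f g : (ι → ℤ) → ℤ}

lemma coord (i : ι) : IsBinomial fun v : ι → ℤ => v i := ⟨.var i, fun _ => rfl⟩

lemma const (n : ℤ) : IsBinomial fun _ : ι → ℤ => n :=
  ⟨.const n, fun _ => by simp [BinomialExpr.eval]⟩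

lemma add (hf : IsBinomial f) (hg : IsBinomial g) : IsBinomial fun v => f v + g v := by
  obtain ⟨e, he⟩ := hf
  obtain ⟨e', he'⟩ := hg
  exact ⟨.add e e', fun v => by simp [BinomialExpr.eval, he, he']⟩

lemma mul (hf : IsBinomial f) (hg : IsBinomial g) : IsBinomial fun v => f v * g v := by
  obtain ⟨e, he⟩ := hf
  obtain ⟨e', he'⟩ := hg
  exact ⟨.mul e e', fun v => by simp [BinomialExpr.eval, he, he']⟩

lemma neg (hf : IsBinomial f) : IsBinomial fun v => -f v := by
  simpa using (const (-1)).mul hf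

lemma choose (hf : IsBinomial f) (k : ℕ) : IsBinomial fun v => Ring.choose (f v) k := by
  obtain ⟨e, he⟩ := hf
  exact ⟨.choose e k, fun v => by simp [BinomialExpr.eval, he]⟩

lemma comp (hf : IsBinomial f) {q : ι → (κ → ℤ) → ℤ} (hq : ∀ i, IsBinomial (q i)) :
    IsBinomial fun v => f fun i => q i v := by
  obtain ⟨e, he⟩ := hf
  choose p hp using hq
  exact ⟨e.subst p, fun v => by simp [BinomialExpr.eval_subst, he, hp]⟩

lemma sum {α : Type} (s : Finset α) {F : α → (ι → ℤ) → ℤ} (hF : ∀ a, IsBinomial (F a)) :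
    IsBinomial fun v => ∑ a ∈ s, F a v := by
  classical
  induction s using Finset.induction_on with
  | empty => simpa using const 0
  | insert a s ha ih => simpa [Finset.sum_insert ha] using (hF a).add ih

lemma update [DecidableEq ι] (i : ι) {p : (κ → ℤ) → ℤ} (hp : IsBinomial p)
    {q : ι → (κ → ℤ) → ℤ} (hq : ∀ i, IsBinomial (q i)) (j : ι) :
    IsBinomial fun v => Function.update (fun i => q i v) i (p v) j := by
  by_cases h : j = i
  · subst h
    simpa using hp
  · simpa [h] using hq j

end IsBinomial

/-- Two functions on `ℤ` with the same value at `0` which satisfy the same recursion, given by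
permutations, are equal; invertibility of the steps takes care of the negative integers. -/
lemma int_funext_of_step {α : Type*} (T : ℤ → Equiv.Perm α) {f g : ℤ → α} (h0 : f 0 = g 0)
    (hf : ∀ s, f (s + 1) = T s (f s)) (hg : ∀ s, g (s + 1) = T s (g s)) (s : ℤ) : f s = g s := by
  induction s using Int.induction_on with
  | zero => exact h0
  | succ n ih => rw [hf, hg, ih]
  | pred n ih =>
    have h1 := hf (-n - 1)
    have h2 := hg (-n - 1)
    rw [sub_add_cancel] at h1 h2
    exact (T _).injective (by rw [← h1, ← h2, ih])

/-- Newton's interpolation formula on the integers. -/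
lemma eq_sum_fwdDiff_mul_choose (D : ℕ) : ∀ f : ℤ → ℤ, (fwdDiff 1)^[D] f = 0 → ∀ s,
    f s = ∑ k ∈ Finset.range D, (fwdDiff 1)^[k] f 0 * Ring.choose s k := by
  induction D with
  | zero => intro f hf s; simpa using congrFun hf s
  | succ D ih =>
    intro f hf
    have h1 := ih (fwdDiff 1 f) hf
    refine int_funext_of_step (fun s => Equiv.addRight (fwdDiff 1 f s)) ?_ ?_ ?_
    · rw [Finset.sum_range_succ']
      simp
    · intro s
      simp [fwdDiff]
    · intro s
      rw [Equiv.coe_addRight, h1 s, Finset.sum_range_succ', Finset.sum_range_succ']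
      simp only [Ring.choose_succ_succ, mul_add, Finset.sum_add_distrib, Ring.choose_zero_right,
        Function.iterate_succ_apply]
      ring

/-- Integer-valued polynomials have bounded degree in each variable. -/
lemma IsBinomial.exists_fwdDiff_eq_zero {ι : Type} [DecidableEq ι] {f : (ι → ℤ) → ℤ}
    (hf : IsBinomial f) (i : ι) :
    ∃ D : ℕ, ∀ v : ι → ℤ, (fwdDiff 1)^[D] (fun s => f (Function.update v i s)) = 0 := by
  obtain ⟨e, he⟩ := hf
  obtain ⟨d, P, hd, hP⟩ := e.isRatPolynomial_eval (R := ℤ)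
  refine ⟨P.totalDegree * 1 + 1, fun v => ?_⟩
  let q : ι → Polynomial ℤ := Function.update (fun j => Polynomial.C (v j)) i Polynomial.X
  have hdeg := MvPolynomial.aeval_natDegree_le P le_rfl q (n := 1) fun j => by
    by_cases h : j = i
    · subst h; simp [q]
    · simp [q, h]
  have h1 := Polynomial.fwdDiff_iter_eq_zero_of_degree_lt (Nat.lt_succ_of_le hdeg)
  have h2 : (MvPolynomial.aeval q P).eval = (d : ℤ) • fun s => f (Function.update v i s) := by
    funext s
    rw [Pi.smul_apply, smul_eq_mul, he]
    have := hP (Function.update v i s)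
    rw [show ((d : ℤ) * _ = _) from this]
    rw [← Polynomial.coe_aeval_eq_eval, MvPolynomial.comp_aeval_apply]
    congr 2
    funext j
    by_cases h : j = i
    · subst h; simp [q]
    · simp [q, h]
  rw [h2, fwdDiff_iter_const_smul] at h1
  exact (smul_eq_zero.1 h1).resolve_left (by exact_mod_cast hd)

/-- Integer-valued polynomials can be summed along each variable. -/
lemma IsBinomial.exists_sum {ι : Type} [DecidableEq ι] {f : (ι → ℤ) → ℤ} (hf : IsBinomial f)
    (i : ι) : ∃ g : (ι → ℤ) → ℤ, IsBinomial g ∧ (∀ v, g (Function.update v i 0) = 0) ∧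
      ∀ v, g (Function.update v i (v i + 1)) = g v + f v := by
  obtain ⟨D, hD⟩ := hf.exists_fwdDiff_eq_zero i
  let c : ℕ → (ι → ℤ) → ℤ := fun k v => (fwdDiff 1)^[k] (fun s => f (Function.update v i s)) 0
  have hc : ∀ k, IsBinomial (c k) := fun k => by
    simp only [c, fwdDiff_iter_eq_sum_shift, smul_eq_mul]
    exact IsBinomial.sum _ fun j => (IsBinomial.const _).mul
      (hf.comp (IsBinomial.update i (IsBinomial.const _) IsBinomial.coord))
  have hcu : ∀ k v s, c k (Function.update v i s) = c k v := fun k v s => by simp [c]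
  refine ⟨fun v => ∑ k ∈ Finset.range D, c k v * Ring.choose (v i) (k + 1),
    IsBinomial.sum _ fun k => (hc k).mul ((IsBinomial.coord i).choose _), fun v => ?_, fun v => ?_⟩
  · simp
  · have h1 := eq_sum_fwdDiff_mul_choose D _ (hD v) (v i)
    rw [Function.update_eq_self] at h1
    rw [h1, ← Finset.sum_add_distrib]
    refine Finset.sum_congr rfl fun k _ => ?_
    rw [hcu, Function.update_self, Ring.choose_succ_succ]
    simp only [c]
    ring

/-! ### Hall's polynomials -/

section PolyMap

variable {N : Type u} [Group N]

/-- A map from `ℤ^ι` to a group is polynomial with respect to the list `x₁, …, x_h` if it is of the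
form `v ↦ x₁ ^ a₁(v) ⋯ x_h ^ a_h(v)` with integer-valued polynomials `a_k`. -/
def IsPolyMap {ι : Type} : List N → ((ι → ℤ) → N) → Prop
  | [], F => ∀ v, F v = 1
  | x :: l, F => ∃ (a : (ι → ℤ) → ℤ) (F' : (ι → ℤ) → N), IsBinomial a ∧ IsPolyMap l F' ∧
      ∀ v, F v = x ^ a v * F' v

namespace IsPolyMap

variable {ι κ : Type}

lemma comp : ∀ {l : List N} {F : (ι → ℤ) → N}, IsPolyMap l F → ∀ {q : ι → (κ → ℤ) → ℤ},
    (∀ i, IsBinomial (q i)) → IsPolyMap l fun v => F fun i => q i v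
  | [], _, hF, _, _ => fun _ => hF _
  | _ :: _, _, ⟨_, _, ha, hF', h⟩, _, hq =>
    ⟨_, _, ha.comp hq, hF'.comp hq, fun _ => h _⟩

lemma one : ∀ l : List N, IsPolyMap l fun _ : ι → ℤ => (1 : N)
  | [] => fun _ => rfl
  | _ :: l => ⟨_, _, IsBinomial.const 0, one l, fun _ => by simp⟩

lemma cons (x : N) {l : List N} {F : (ι → ℤ) → N} (hF : IsPolyMap l F) : IsPolyMap (x :: l) F :=
  ⟨_, _, IsBinomial.const 0, hF, fun _ => by simp⟩

lemma const_of_mem {y : N} : ∀ {l : List N}, y ∈ l → IsPolyMap l fun _ : ι → ℤ => y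
  | x :: l, h => by
    rcases List.mem_cons.1 h with rfl | h
    · exact ⟨_, _, IsBinomial.const 1, one l, fun _ => by simp⟩
    · exact (const_of_mem h).cons x

lemma congr {l : List N} {F G : (ι → ℤ) → N} (hF : IsPolyMap l F) (h : ∀ v, G v = F v) :
    IsPolyMap l G := by
  rwa [show G = F from funext h]

end IsPolyMap

/-- The polynomial maps with respect to a list are closed under pointwise products and
under the discrete analogue `Φ(s) = F(0) F(1) ⋯ F(s - 1)` of integration along any variable. -/
structure IsPolyClosed (l : List N) : Prop where
  mul : ∀ {ι : Type} {F G : (ι → ℤ) → N}, IsPolyMap l F → IsPolyMap l G →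
    IsPolyMap l fun v => F v * G v
  integral : ∀ {ι : Type} [DecidableEq ι] {F : (ι → ℤ) → N} (i : ι), IsPolyMap l F →
    ∃ Φ : (ι → ℤ) → N, IsPolyMap l Φ ∧ (∀ v, Φ (Function.update v i 0) = 1) ∧
      ∀ v, Φ (Function.update v i (v i + 1)) = Φ v * F v

namespace IsPolyClosed

variable {l : List N} {ι : Type}

/-- The power `F ^ s` is the integral of the constant map `F` up to `s`. -/
lemma zpow (hl : IsPolyClosed l) {F : (ι → ℤ) → N} (hF : IsPolyMap l F) {p : (ι → ℤ) → ℤ}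
    (hp : IsBinomial p) : IsPolyMap l fun v => F v ^ p v := by
  classical
  have h1 : IsPolyMap l fun w : Option ι → ℤ => F fun i => w (some i) :=
    hF.comp fun i => IsBinomial.coord (some i)
  obtain ⟨Φ, hΦ, h0, hs⟩ := hl.integral none h1
  have key : ∀ (v : ι → ℤ) (s : ℤ),
      Φ (fun o => o.elim s v) = F v ^ s := by
    intro v
    refine int_funext_of_step (fun _ => Equiv.mulRight (F v)) ?_ ?_ ?_
    · rw [zpow_zero, ← h0 fun o => o.elim 0 v]
      congr 1
      funext o
      cases o <;> simp
    · intro s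
      refine Eq.trans ?_ (hs fun o => o.elim s v)
      congr 1
      funext o
      cases o <;> simp
    · intro s
      simp [zpow_add_one]
  have h2 := hΦ.comp (q := fun o v => o.elim (p v) v) (by
    rintro (_ | i)
    · exact hp
    · exact IsBinomial.coord i)
  exact h2.congr fun v => (key v (p v)).symm

lemma inv (hl : IsPolyClosed l) {F : (ι → ℤ) → N} (hF : IsPolyMap l F) :
    IsPolyMap l fun v => (F v)⁻¹ := by
  simpa using hl.zpow hF (IsBinomial.const (-1))

/-- The elements whose orbit under conjugation by the powers of `x` is a polynomial map. -/
def orbitSubgroup (hl : IsPolyClosed l) (x : N) : Subgroup N where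
  carrier := {w | IsPolyMap l fun t : Unit → ℤ => x ^ (-t ()) * w * x ^ t ()}
  one_mem' := (IsPolyMap.one l).congr fun t => by simp
  mul_mem' ha hb := (hl.mul ha hb).congr fun t => by group
  inv_mem' ha := (hl.inv ha).congr fun t => by group

lemma mem_orbitSubgroup (hl : IsPolyClosed l) {x w : N} : w ∈ hl.orbitSubgroup x ↔
    IsPolyMap l fun t : Unit → ℤ => x ^ (-t ()) * w * x ^ t () := Iff.rfl

/-- If `y` is central modulo a subgroup of elements with polynomial orbits, then the orbit of `y`
is polynomial, as it is obtained by integrating the orbit of the commutator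
of `y` and `x`. -/
lemma closureList_le_orbitSubgroup (hl : IsPolyClosed l) (x : N) : ∀ {l' : List N},
    IsCentralList l' → l' ⊆ l → closureList l' ≤ hl.orbitSubgroup x
  | [], _, _ => by simp
  | y :: l', hc, hsub => by
    have ih := hl.closureList_le_orbitSubgroup x hc.2 (List.subset_of_cons_subset hsub)
    rw [closureList_cons, sup_le_iff, Subgroup.zpowers_le]
    refine ⟨?_, ih⟩
    have := hc.2.normal
    have hw : y⁻¹ * x⁻¹ * y * x ∈ closureList l' := by
      have h1 := this.conj_mem _ (inv_mem (hc.1 x⁻¹)) y⁻¹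
      convert h1 using 1
      group
    obtain ⟨Φ, hΦ, h0, hs⟩ := hl.integral () (hl.mem_orbitSubgroup.1 (ih hw))
    -- the orbit of `y` is multiplied by `x ^ (-s) * (y⁻¹ * x⁻¹ * y * x) * x ^ s` in step `s`
    have key : ∀ s : ℤ, x ^ (-s) * y * x ^ s = y * Φ fun _ => s := by
      refine int_funext_of_step
        (fun s => Equiv.mulRight (x ^ (-s) * (y⁻¹ * x⁻¹ * y * x) * x ^ s)) ?_ ?_ ?_
      · have h1 := h0 fun _ => 0
        rw [Function.update_eq_self_iff.2 rfl] at h1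
        simp [h1]
      · intro s
        rw [Equiv.coe_mulRight]
        group
      · intro s
        have h2 := hs fun _ => s
        have h3 : Function.update (fun _ : Unit => s) () (s + 1) = fun _ => s + 1 :=
          funext fun _ => rfl
        rw [← h3, h2]
        exact (mul_assoc _ _ _).symm
    refine (hl.mul (IsPolyMap.const_of_mem (hsub List.mem_cons_self)) hΦ).congr fun t => ?_
    exact key (t ())

/-- Conjugation by `x ^ p(v)` preserves polynomial maps: it acts on each factor of the product
in coordinates through the orbit of a basis element. -/
lemma conj (hl : IsPolyClosed l) (hc : IsCentralList l) (x : N) {p : (ι → ℤ) → ℤ}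
    (hp : IsBinomial p) {F : (ι → ℤ) → N} (hF : IsPolyMap l F) :
    IsPolyMap l fun v => x ^ (-p v) * F v * x ^ p v := by
  have hS := hl.closureList_le_orbitSubgroup x hc (List.Subset.refl l)
  have key : ∀ {l' : List N}, l' ⊆ l → ∀ {F : (ι → ℤ) → N}, IsPolyMap l' F →
      IsPolyMap l fun v => x ^ (-p v) * F v * x ^ p v := by
    intro l'
    induction l' with
    | nil => exact fun _ F hF => (IsPolyMap.one l).congr fun v => by rw [hF v]; simp
    | cons y l' ih =>
      rintro hsub F ⟨a, F', ha, hF', h⟩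
      have hy := hl.mem_orbitSubgroup.1 (hS (mem_closureList (hsub List.mem_cons_self)))
      have h1 := hl.zpow (hy.comp (q := fun _ => p) fun _ => hp) ha
      refine (hl.mul h1 (ih (List.subset_of_cons_subset hsub) hF')).congr fun v => ?_
      have h2 : x ^ (-p v) * y * x ^ p v = (x ^ p v)⁻¹ * y * ((x ^ p v)⁻¹)⁻¹ := by group
      rw [h, h2, conj_zpow]
      group
  exact key (List.Subset.refl l) hF

lemma cons (hl : IsPolyClosed l) (hc : IsCentralList l) (x : N) : IsPolyClosed (x :: l) where
  mul := by
    rintro ι F G ⟨a, F', ha, hF', hF⟩ ⟨b, G', hb, hG', hG⟩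
    refine ⟨_, _, ha.add hb, hl.mul (hl.conj hc x hb hF') hG', fun v => ?_⟩
    simp only [hF, hG]
    group
  integral := by
    rintro ι _ F i ⟨a, F', ha, hF', hF⟩
    obtain ⟨A, hA, hA0, hA1⟩ := ha.exists_sum i
    obtain ⟨Ψ, hΨ, hΨ0, hΨ1⟩ := hl.integral i (hl.conj hc x (hA.add ha).neg hF')
    -- the integral is `Ψ x ^ A`, written in the order prescribed by the list
    refine ⟨_, ⟨A, _, hA, hl.conj hc x hA hΨ, fun v => rfl⟩, fun v => ?_, fun v => ?_⟩
    · simp [hA0, hΨ0]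
    · simp only [hA1, hΨ1, hF]
      group

end IsPolyClosed

/-- The polynomial maps with respect to a central series with cyclic factors are closed under
products and integration. This is the source of Hall's polynomials. -/
lemma IsCentralList.isPolyClosed : ∀ {l : List N}, IsCentralList l → IsPolyClosed l
  | [], _ =>
    { mul := fun hF hG v => by simp only [hF v, hG v, mul_one]
      integral := fun _ hF => ⟨fun _ => 1, fun _ => rfl, fun _ => rfl, fun v => by
        rw [hF v, mul_one]⟩ }
  | x :: _, h => (IsCentralList.isPolyClosed h.2).cons h.2 x

end PolyMap

section Coordinates

variable {N : Type u} [Group N] {R : Type v} {h : ℕ}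

@[simp]
lemma coordProd_zero_length {H : Type u} [Group H] [Pow H R] (x : Fin 0 → H) (a : Fin 0 → R) :
    coordProd x a = 1 := by
  simp [coordProd]

lemma coordProd_succ {H : Type u} [Group H] [Pow H R] (x : Fin (h + 1) → H)
    (a : Fin (h + 1) → R) :
    coordProd x a = x 0 ^ a 0 * coordProd (Fin.tail x) (Fin.tail a) := by
  rw [coordProd, List.ofFn_succ, List.prod_cons]
  rfl

lemma coordProd_mem (x : Fin h → N) (a : Fin h → ℤ) :
    coordProd x a ∈ closureList (List.ofFn x) := by
  refine Subgroup.list_prod_mem _ fun y hy => ?_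
  obtain ⟨k, rfl⟩ := List.mem_ofFn.1 hy
  exact zpow_mem (mem_closureList (List.mem_ofFn.2 ⟨k, rfl⟩)) _

/-- Polynomial maps are those whose coordinates are integer-valued polynomials. -/
lemma isPolyMap_ofFn_iff {ι : Type} (x : Fin h → N) {F : (ι → ℤ) → N} :
    IsPolyMap (List.ofFn x) F ↔ ∃ c : Fin h → BinomialExpr ι,
      ∀ v, F v = coordProd x fun k => (c k).eval v := by
  induction h generalizing F with
  | zero => simp [IsPolyMap, coordProd_zero_length]
  | succ h ih =>
    rw [List.ofFn_succ]
    constructor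
    · rintro ⟨a, F', ⟨e, he⟩, hF', hF⟩
      obtain ⟨c, hc⟩ := (ih (Fin.tail x)).1 hF'
      refine ⟨Fin.cons e c, fun v => ?_⟩
      rw [hF, hc, coordProd_succ, Fin.cons_zero, he]
      rfl
    · rintro ⟨c, hc⟩
      refine ⟨_, _, ⟨c 0, fun v => rfl⟩, (ih (Fin.tail x)).2 ⟨Fin.tail c, fun v => rfl⟩,
        fun v => ?_⟩
      rw [hc, coordProd_succ]
      rfl

lemma IsMalcevBasis.isPolyClosed {x : Fin h → N} (hx : IsMalcevBasis x) :
    IsPolyClosed (List.ofFn x) :=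
  ((isMalcevBasis_iff x).1 hx).2.1.isPolyClosed

lemma IsMalcevBasis.coordProd_surjective {x : Fin h → N} (hx : IsMalcevBasis x) (y : N) :
    ∃ a : Fin h → ℤ, coordProd x a = y := by
  let S : Subgroup N :=
    { carrier := {w | IsPolyMap (List.ofFn x) fun _ : Unit → ℤ => w}
      one_mem' := IsPolyMap.one _
      mul_mem' := hx.isPolyClosed.mul
      inv_mem' := hx.isPolyClosed.inv }
  have hS : closureList (List.ofFn x) ≤ S := closureList_le.2 fun y hy => IsPolyMap.const_of_mem hy
  rw [((isMalcevBasis_iff x).1 hx).1] at hS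
  obtain ⟨c, hc⟩ := (isPolyMap_ofFn_iff x).1 (hS (Subgroup.mem_top y))
  exact ⟨_, (hc fun _ => 0).symm⟩

lemma IsInfiniteList.coordProd_injective {x : Fin h → N} (hx : IsInfiniteList (List.ofFn x)) :
    Function.Injective fun a : Fin h → ℤ => coordProd x a := by
  induction h with
  | zero => exact fun a b _ => Subsingleton.elim _ _
  | succ h ih =>
    intro a b hab
    rw [List.ofFn_succ] at hx
    simp only [coordProd_succ] at hab
    have h1 : x 0 ^ (-b 0 + a 0) = coordProd (Fin.tail x) (Fin.tail b) *
        (coordProd (Fin.tail x) (Fin.tail a))⁻¹ := by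
      rw [eq_mul_inv_iff_mul_eq, zpow_add, mul_assoc, hab, zpow_neg, inv_mul_cancel_left]
    have h2 : -b 0 + a 0 = 0 := hx.1 _ (by
      rw [h1]
      exact mul_mem (coordProd_mem (Fin.tail x) _) (inv_mem (coordProd_mem (Fin.tail x) _)))
    have h3 : a 0 = b 0 := by linarith
    rw [h3] at hab
    have h4 := ih (x := Fin.tail x) hx.2 (mul_left_cancel hab)
    rw [← Fin.cons_self_tail a, ← Fin.cons_self_tail b, h3, h4]

lemma IsMalcevBasis.coordProd_injective {x : Fin h → N} (hx : IsMalcevBasis x) :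
    Function.Injective fun a : Fin h → ℤ => coordProd x a :=
  ((isMalcevBasis_iff x).1 hx).2.2.coordProd_injective

/-- Hall's polynomials: the coordinates of products and powers are polynomials in the
coordinates. -/
lemma IsMalcevBasis.exists_hallExpr {x : Fin h → N} (hx : IsMalcevBasis x) :
    ∃ (f : Fin h → BinomialExpr (Fin h ⊕ Fin h)) (g : Fin h → BinomialExpr (Fin h ⊕ Unit)),
      (∀ a b : Fin h → ℤ, coordProd x a * coordProd x b =
        coordProd x fun k => (f k).eval (Sum.elim a b)) ∧
      ∀ (a : Fin h → ℤ) (n : ℤ), coordProd x a ^ n =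
        coordProd x fun k => (g k).eval (Sum.elim a fun _ => n) := by
  have hcl := hx.isPolyClosed
  have h1 : ∀ {ι : Type} (j : Fin h → ι),
      IsPolyMap (List.ofFn x) fun v : ι → ℤ => coordProd x fun k => v (j k) :=
    fun j => (isPolyMap_ofFn_iff x).2 ⟨fun k => .var (j k), fun v => rfl⟩
  obtain ⟨f, hf⟩ := (isPolyMap_ofFn_iff x).1
    (hcl.mul (h1 (Sum.inl : Fin h → Fin h ⊕ Fin h)) (h1 Sum.inr))
  obtain ⟨g, hg⟩ := (isPolyMap_ofFn_iff x).1
    (hcl.zpow (h1 (Sum.inl : Fin h → Fin h ⊕ Unit)) (IsBinomial.coord (Sum.inr ())))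
  exact ⟨f, g, fun a b => hf (Sum.elim a b), fun a n => hg (Sum.elim a fun _ => n)⟩

end Coordinates

/-! ### The completion of a `τ`-group -/

section CoordProd

variable {R : Type v} {H : Type w} [Group H] [Pow H R]

/-- A class of maps to `H` which is closed under products contains the ordered products of
powers as soon as it contains the factors. -/
lemma coordProd_induction {X : Type*} {C : (X → H) → Prop} (one : C fun _ => 1)
    (mul : ∀ {F G : X → H}, C F → C G → C fun v => F v * G v) {m : ℕ} (z : Fin m → H)
    (a : Fin m → X → R) (h : ∀ k, C fun v => z k ^ a k v) :
    C fun v => coordProd z fun k => a k v := by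
  induction m with
  | zero => simpa [coordProd_zero_length] using one
  | succ m ih =>
    simp only [coordProd_succ]
    exact mul (h 0) (ih (Fin.tail z) (Fin.tail a) fun k => h k.succ)

lemma map_coordProd {H' : Type*} [Group H'] {R' : Type*} [Pow H' R'] (φ : H →* H') {m : ℕ}
    (z : Fin m → H) (a : Fin m → R) (a' : Fin m → R')
    (h : ∀ k, φ (z k ^ a k) = φ (z k) ^ a' k) :
    φ (coordProd z a) = coordProd (fun k => φ (z k)) a' := by
  rw [coordProd, coordProd, map_list_prod, List.map_ofFn]
  simp [Function.comp_def, h]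

lemma coordProd_intCast [CommRing R] {N : Type*} [Group N] (i : N →* H)
    (hpow : ∀ (y : H) (n : ℤ), y ^ (n : R) = y ^ n) {m : ℕ} (x : Fin m → N) (a : Fin m → ℤ) :
    coordProd (fun k => i (x k)) (fun k => (a k : R)) = i (coordProd x a) :=
  (map_coordProd i x a _ fun k => by rw [hpow, map_zpow]).symm

end CoordProd

section HallPoints

/-- Points `(a₁, …, a_h)` with coordinates in `R`, which stand for the formal products
`x₁ ^ a₁ ⋯ x_h ^ a_h` of P. Hall. -/
@[ext]
structure HallPoint (R : Type v) (h : ℕ) where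
  /-- The exponents of a formal product. -/
  coord : Fin h → R

namespace HallPoint

variable {R : Type v} [CommRing R] {h : ℕ}

/-- The point of `R^h` with given integral coordinates. -/
def ofInt (a : Fin h → ℤ) : HallPoint R h := ⟨fun k => a k⟩

/-- A map to `R^h` whose coordinates are polynomials with rational coefficients. -/
def IsRat {ι : Type} (F : (ι → R) → HallPoint R h) : Prop :=
  ∀ k, IsRatPolynomial fun v => (F v).coord k

lemma isRat_coord {ι : Type} (j : Fin h → ι) :
    IsRat fun v : ι → R => (⟨fun k => v (j k)⟩ : HallPoint R h) :=
  fun k => isRatPolynomial_coord (j k)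

lemma isRat_ofInt {ι : Type} (a : Fin h → ℤ) : IsRat fun _ : ι → R => (ofInt a : HallPoint R h) :=
  fun k => isRatPolynomial_intCast (a k)

lemma IsRat.funext [IsDomain R] [CharZero R] {ι : Type} {F G : (ι → R) → HallPoint R h}
    (hF : IsRat F) (hG : IsRat G)
    (hFG : ∀ v : ι → ℤ, F (fun i => (v i : R)) = G fun i => (v i : R)) (v : ι → R) :
    F v = G v :=
  HallPoint.ext <| _root_.funext fun k =>
    (hF k).funext (hG k) (fun v => congrFun (congrArg coord (hFG v)) k) v

end HallPoint

variable {N : Type u} [Group N] (R : Type v) [CommRing R] {h : ℕ}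

/-- A system of Hall polynomials for the Mal'cev basis `x`: expressions for the coordinates of
products and of powers. -/
structure HallExpr (x : Fin h → N) where
  /-- The polynomials describing products. -/
  mulExpr : Fin h → BinomialExpr (Fin h ⊕ Fin h)
  /-- The polynomials describing powers. -/
  powExpr : Fin h → BinomialExpr (Fin h ⊕ Unit)
  basis : IsMalcevBasis x
  coordProd_mul : ∀ a b : Fin h → ℤ, coordProd x a * coordProd x b =
    coordProd x fun k => (mulExpr k).eval (Sum.elim a b)
  coordProd_zpow : ∀ (a : Fin h → ℤ) (n : ℤ), coordProd x a ^ n =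
    coordProd x fun k => (powExpr k).eval (Sum.elim a fun _ => n)

namespace HallExpr

open HallPoint

variable {R} {x : Fin h → N} (E : HallExpr x)

variable (R) in
/-- The map from the group to its formal completion, taking an element to its coordinates. -/
noncomputable def toPoint (y : N) : HallPoint R h := ofInt (E.basis.coordProd_surjective y).choose

lemma toPoint_coordProd (a : Fin h → ℤ) : E.toPoint R (coordProd x a) = ofInt a :=
  congrArg ofInt (E.basis.coordProd_injective (E.basis.coordProd_surjective _).choose_spec)

lemma toPoint_one : E.toPoint R 1 = ofInt 0 := by
  rw [← E.toPoint_coordProd]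
  congr 1
  simp [coordProd]

variable [BinomialRing R]

/-- The product of two points, given by Hall's polynomials. -/
def mul (a b : HallPoint R h) : HallPoint R h :=
  ⟨fun k => (E.mulExpr k).eval (Sum.elim a.coord b.coord)⟩

/-- The power of a point with exponent in `R`, given by Hall's polynomials. -/
def pow (a : HallPoint R h) (r : R) : HallPoint R h :=
  ⟨fun k => (E.powExpr k).eval (Sum.elim a.coord fun _ => r)⟩

lemma isRat_mul {ι : Type} {F G : (ι → R) → HallPoint R h} (hF : IsRat F) (hG : IsRat G) :
    IsRat fun v => E.mul (F v) (G v) := by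
  intro k
  refine ((E.mulExpr k).isRatPolynomial_eval (R := R)).comp
    (q := fun j v => Sum.elim (F v).coord (G v).coord j) ?_
  rintro (j | j)
  exacts [hF j, hG j]

lemma isRat_pow {ι : Type} {F : (ι → R) → HallPoint R h} {p : (ι → R) → R} (hF : IsRat F)
    (hp : IsRatPolynomial p) : IsRat fun v => E.pow (F v) (p v) := by
  intro k
  refine ((E.powExpr k).isRatPolynomial_eval (R := R)).comp
    (q := fun j v => Sum.elim (F v).coord (fun _ => p v) j) ?_
  rintro (j | j)
  exacts [hF j, hp]

lemma toPoint_mul (y z : N) : E.toPoint R (y * z) = E.mul (E.toPoint R y) (E.toPoint R z) := by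
  obtain ⟨a, rfl⟩ := E.basis.coordProd_surjective y
  obtain ⟨b, rfl⟩ := E.basis.coordProd_surjective z
  rw [E.coordProd_mul, toPoint_coordProd, toPoint_coordProd, toPoint_coordProd]
  ext k
  simp only [ofInt, mul]
  rw [← BinomialExpr.eval_intCast]
  congr 1
  funext j
  cases j <;> rfl

lemma toPoint_zpow (y : N) (n : ℤ) : E.toPoint R (y ^ n) = E.pow (E.toPoint R y) n := by
  obtain ⟨a, rfl⟩ := E.basis.coordProd_surjective y
  rw [E.coordProd_zpow, toPoint_coordProd, toPoint_coordProd]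
  ext k
  simp only [ofInt, pow]
  rw [← BinomialExpr.eval_intCast]
  congr 1
  funext j
  cases j <;> rfl

variable [IsDomain R] [CharZero R]

lemma mul_assoc' (a b c : HallPoint R h) : E.mul (E.mul a b) c = E.mul a (E.mul b c) := by
  have ha := isRat_coord (R := R) (ι := Fin h ⊕ Fin h ⊕ Fin h) Sum.inl
  have hb := isRat_coord (R := R) (ι := Fin h ⊕ Fin h ⊕ Fin h) (Sum.inr ∘ Sum.inl)
  have hc := isRat_coord (R := R) (ι := Fin h ⊕ Fin h ⊕ Fin h) (Sum.inr ∘ Sum.inr)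
  refine IsRat.funext (E.isRat_mul (E.isRat_mul ha hb) hc) (E.isRat_mul ha (E.isRat_mul hb hc))
    (fun v => ?_) (Sum.elim a.coord (Sum.elim b.coord c.coord))
  change E.mul (E.mul (ofInt _) (ofInt _)) (ofInt _) = E.mul (ofInt _) (E.mul (ofInt _) (ofInt _))
  simp only [← E.toPoint_coordProd, ← E.toPoint_mul, mul_assoc]

lemma one_mul' (a : HallPoint R h) : E.mul (ofInt 0) a = a := by
  have ha := isRat_coord (R := R) (id : Fin h → Fin h)
  refine IsRat.funext (E.isRat_mul (isRat_ofInt 0) ha) ha (fun v => ?_) a.coord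
  change E.mul (ofInt 0) (ofInt _) = ofInt _
  rw [← E.toPoint_one, ← E.toPoint_coordProd, ← E.toPoint_mul, one_mul]

lemma pow_zero' (a : HallPoint R h) : E.pow a 0 = ofInt 0 := by
  have ha := isRat_coord (R := R) (id : Fin h → Fin h)
  have h0 := isRatPolynomial_intCast (R := R) (ι := Fin h) 0
  have := IsRat.funext (E.isRat_pow ha h0) (isRat_ofInt 0) (fun v => ?_) a.coord
  · simpa using this
  change E.pow (ofInt _) _ = ofInt 0
  rw [← E.toPoint_one, ← E.toPoint_coordProd, ← E.toPoint_zpow, zpow_zero]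

lemma pow_add_one' (a : HallPoint R h) (r : R) : E.pow a (r + 1) = E.mul (E.pow a r) a := by
  have ha := isRat_coord (R := R) (Sum.inl : Fin h → Fin h ⊕ Unit)
  have hr := isRatPolynomial_coord (R := R) (Sum.inr () : Fin h ⊕ Unit)
  have h1 := isRatPolynomial_intCast (R := R) (ι := Fin h ⊕ Unit) 1
  have := IsRat.funext (E.isRat_pow ha (hr.add h1)) (E.isRat_mul (E.isRat_pow ha hr) ha)
    (fun v => ?_) (Sum.elim a.coord fun _ => r)
  · simpa using this
  change E.pow (ofInt _) _ = E.mul (E.pow (ofInt _) _) (ofInt _)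
  rw [← Int.cast_add, ← E.toPoint_coordProd, ← E.toPoint_zpow, ← E.toPoint_zpow, ← E.toPoint_mul,
    zpow_add_one]

lemma inv_mul_cancel' (a : HallPoint R h) : E.mul (E.pow a (-1)) a = ofInt 0 := by
  rw [← E.pow_add_one', neg_add_cancel, E.pow_zero']

/-- The group structure on `R^h` given by Hall's polynomials. -/
@[reducible]
def group : Group (HallPoint R h) :=
  letI : Mul (HallPoint R h) := ⟨E.mul⟩
  letI : One (HallPoint R h) := ⟨ofInt 0⟩
  letI : Inv (HallPoint R h) := ⟨fun a => E.pow a (-1)⟩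
  Group.ofLeftAxioms E.mul_assoc' E.one_mul' E.inv_mul_cancel'

theorem isMalcevCompletion (E : HallExpr x) :
    ∃ (_ : Group (HallPoint R h)) (_ : Pow (HallPoint R h) R) (i : N →* HallPoint R h),
      IsMalcevCompletion R i := by
  let instG : Group (HallPoint R h) := E.group
  let instP : Pow (HallPoint R h) R := ⟨E.pow⟩
  have hmul : ∀ a b : HallPoint R h, a * b = E.mul a b := fun _ _ => rfl
  have hone : (1 : HallPoint R h) = ofInt 0 := rfl
  have hpow : ∀ (a : HallPoint R h) (r : R), a ^ r = E.pow a r := fun _ _ => rfl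
  let i : N →* HallPoint R h := ⟨⟨E.toPoint R, E.toPoint_one⟩, E.toPoint_mul⟩
  have hint : ∀ (y : HallPoint R h) (n : ℤ), y ^ (n : R) = y ^ n := by
    intro y
    refine int_funext_of_step (fun _ => Equiv.mulRight y) ?_ ?_ ?_
    · rw [zpow_zero, hpow, Int.cast_zero, E.pow_zero', hone]
    · intro s
      rw [hpow, hpow, Int.cast_add, Int.cast_one, E.pow_add_one']
      rfl
    · intro s
      rw [zpow_add_one]
      rfl
  -- the coordinates of the formal product with exponents `a` are `a`: true for integral `a`
  have hcoord : ∀ a : Fin h → R, coordProd (fun k => i (x k)) a = ⟨a⟩ := by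
    refine IsRat.funext ?_ (isRat_coord id) fun v => ?_
    · exact coordProd_induction (C := fun F => IsRat F) (isRat_ofInt 0) E.isRat_mul _
        (fun k v => v k) fun k => E.isRat_pow (isRat_ofInt _) (isRatPolynomial_coord k)
    · rw [coordProd_intCast i hint]
      exact E.toPoint_coordProd v
  refine ⟨instG, instP, i, hint, h, x, E.basis, ?_, ?_, ?_⟩
  · simp only [hcoord]
    exact ⟨fun a b hab => congrArg coord hab, fun y => ⟨y.coord, rfl⟩⟩
  · refine ⟨fun k v => (E.mulExpr k).eval v, fun k => (E.mulExpr k).isRatPolynomial_eval, ?_⟩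
    simp only [hcoord]
    exact fun a b => rfl
  · refine ⟨fun k v => (E.powExpr k).eval v, fun k => (E.powExpr k).isRatPolynomial_eval, ?_⟩
    simp only [hcoord]
    exact fun a r => rfl

end HallExpr

theorem IsTauGroup.exists_isMalcevCompletion [IsDomain R] [BinomialRing R] [CharZero R]
    (hN : IsTauGroup N) :
    ∃ (N' : Type v) (_ : Group N') (_ : Pow N' R) (i : N →* N'), IsMalcevCompletion R i := by
  obtain ⟨h, x, hx⟩ := hN.exists_isMalcevBasis
  obtain ⟨f, g, hf, hg⟩ := hx.exists_hallExpr
  exact ⟨HallPoint R h, HallExpr.isMalcevCompletion ⟨f, g, hx, hf, hg⟩⟩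

end HallPoints

/-! ### Extension of homomorphisms to completions -/

section Extension

variable {R : Type v} [CommRing R]

/-- The data of a completion `i : N →* N'` with respect to a chosen Mal'cev basis `x`. -/
structure IsCompletionBasis (R : Type v) [CommRing R] {N : Type*} {N' : Type*} [Group N] [Group N']
    [Pow N' R] (i : N →* N') {h : ℕ} (x : Fin h → N) : Prop where
  pow_intCast : ∀ (y : N') (n : ℤ), y ^ (n : R) = y ^ n
  basis : IsMalcevBasis x
  bijective : Function.Bijective (fun a : Fin h → R => coordProd (fun k => i (x k)) a)
  mul : ∃ f : Fin h → (Fin h ⊕ Fin h → R) → R, (∀ k, IsRatPolynomial (f k)) ∧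
    ∀ a b : Fin h → R, coordProd (fun k => i (x k)) a * coordProd (fun k => i (x k)) b =
      coordProd (fun k => i (x k)) (fun k => f k (Sum.elim a b))
  pow : ∃ g : Fin h → (Fin h ⊕ Unit → R) → R, (∀ k, IsRatPolynomial (g k)) ∧
    ∀ (a : Fin h → R) (r : R), (coordProd (fun k => i (x k)) a) ^ r =
      coordProd (fun k => i (x k)) (fun k => g k (Sum.elim a (fun _ => r)))

lemma IsMalcevCompletion.exists_isCompletionBasis {N : Type*} {N' : Type*} [Group N] [Group N']
    [Pow N' R] {i : N →* N'} (hi : IsMalcevCompletion R i) :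
    ∃ (h : ℕ) (x : Fin h → N), IsCompletionBasis R i x := by
  obtain ⟨h, x, h1, h2, h3, h4⟩ := hi.exists_basis
  exact ⟨h, x, hi.pow_intCast, h1, h2, h3, h4⟩

/-- A map from `R^ι` to a group with powers whose coordinates with respect to `z` are
polynomials with rational coefficients. -/
def IsRatMap {H : Type w} [Group H] [Pow H R] {h : ℕ} (z : Fin h → H) {ι : Type}
    (F : (ι → R) → H) : Prop :=
  ∃ c : Fin h → (ι → R) → R, (∀ k, IsRatPolynomial (c k)) ∧ ∀ v, F v = coordProd z fun k => c k v

namespace IsCompletionBasis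

variable {N : Type*} {N' : Type*} [Group N] [Group N'] [Pow N' R] {i : N →* N'} {h : ℕ}
  {x : Fin h → N} {ι κ : Type}

lemma exists_intCoord (hi : IsCompletionBasis R i x) (n : N) :
    ∃ a : Fin h → ℤ, coordProd (fun k => i (x k)) (fun k => (a k : R)) = i n := by
  obtain ⟨a, rfl⟩ := hi.basis.coordProd_surjective n
  exact ⟨a, coordProd_intCast i hi.pow_intCast x a⟩

lemma isRatMap_coord (j : Fin h → ι) :
    IsRatMap (fun k => i (x k)) fun v : ι → R => coordProd (fun k => i (x k)) fun k => v (j k) :=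
  ⟨fun k v => v (j k), fun _ => isRatPolynomial_coord _, fun _ => rfl⟩

lemma isRatMap_const (hi : IsCompletionBasis R i x) (n : N) :
    IsRatMap (fun k => i (x k)) fun _ : ι → R => i n := by
  obtain ⟨a, ha⟩ := hi.exists_intCoord n
  exact ⟨fun k _ => (a k : R), fun k => isRatPolynomial_intCast _, fun _ => ha.symm⟩

lemma isRatMap_mul (hi : IsCompletionBasis R i x) {F G : (ι → R) → N'}
    (hF : IsRatMap (fun k => i (x k)) F) (hG : IsRatMap (fun k => i (x k)) G) :
    IsRatMap (fun k => i (x k)) fun v => F v * G v := by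
  obtain ⟨c, hc, hF⟩ := hF
  obtain ⟨d, hd, hG⟩ := hG
  obtain ⟨f, hf, hf'⟩ := hi.mul
  refine ⟨fun k v => f k (Sum.elim (fun k => c k v) fun k => d k v), fun k => ?_, fun v => ?_⟩
  · refine (hf k).comp (q := fun j v => Sum.elim (fun k => c k v) (fun k => d k v) j) ?_
    rintro (j | j)
    exacts [hc j, hd j]
  · simp only [hF, hG, hf']

lemma isRatMap_pow (hi : IsCompletionBasis R i x) {F : (ι → R) → N'} {p : (ι → R) → R}
    (hF : IsRatMap (fun k => i (x k)) F) (hp : IsRatPolynomial p) :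
    IsRatMap (fun k => i (x k)) fun v => F v ^ p v := by
  obtain ⟨c, hc, hF⟩ := hF
  obtain ⟨g, hg, hg'⟩ := hi.pow
  refine ⟨fun k v => g k (Sum.elim (fun k => c k v) fun _ => p v), fun k => ?_, fun v => ?_⟩
  · refine (hg k).comp (q := fun j v => Sum.elim (fun k => c k v) (fun _ => p v) j) ?_
    rintro (j | j)
    exacts [hc j, hp]
  · simp only [hF, hg']

lemma isRatMap_inv (hi : IsCompletionBasis R i x) {F : (ι → R) → N'}
    (hF : IsRatMap (fun k => i (x k)) F) : IsRatMap (fun k => i (x k)) fun v => (F v)⁻¹ := by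
  have h1 := hi.isRatMap_pow hF (isRatPolynomial_intCast (-1))
  simp only [hi.pow_intCast, zpow_neg_one] at h1
  exact h1

lemma isRatMap_coordProd (hi : IsCompletionBasis R i x) {m : ℕ} (n : Fin m → N)
    {c : Fin m → (ι → R) → R} (hc : ∀ k, IsRatPolynomial (c k)) :
    IsRatMap (fun k => i (x k)) fun v => coordProd (fun k => i (n k)) fun k => c k v := by
  refine coordProd_induction (C := IsRatMap fun k => i (x k)) ?_ hi.isRatMap_mul _ c fun k =>
    hi.isRatMap_pow (hi.isRatMap_const (n k)) (hc k)
  simpa using hi.isRatMap_const (1 : N)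

/-- Maps with polynomial coordinates agree if they agree on integral points. -/
lemma isRatMap_funext [IsDomain R] [CharZero R] {z : Fin h → N'} {F G : (ι → R) → N'}
    (hinj : Function.Injective fun a : Fin h → R => coordProd z a)
    (hF : IsRatMap z F) (hG : IsRatMap z G)
    (hFG : ∀ v : ι → ℤ, F (fun i => (v i : R)) = G fun i => (v i : R)) (v : ι → R) :
    F v = G v := by
  obtain ⟨c, hc, hF⟩ := hF
  obtain ⟨d, hd, hG⟩ := hG
  rw [hF, hG]
  congr 1
  funext k
  refine (hc k).funext (hd k) (fun v => ?_) v
  have h1 := hFG v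
  rw [hF, hG] at h1
  exact congrFun (hinj h1) k

/-- Two `R`-morphisms on a completion which agree on the original group are equal. -/
lemma hom_ext (hi : IsCompletionBasis R i x) {H : Type*} [Group H] [Pow H R] {φ ψ : N' →* H}
    (hφ : IsRMorphism R φ) (hψ : IsRMorphism R ψ) (h : φ.comp i = ψ.comp i) : φ = ψ := by
  ext y
  obtain ⟨a, rfl⟩ := hi.bijective.2 y
  simp only
  rw [map_coordProd φ _ a a fun k => hφ _ _, map_coordProd ψ _ a a fun k => hψ _ _]
  congr 1
  funext k
  exact DFunLike.congr_fun h (x k)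

variable [IsDomain R] [CharZero R]

/-- Conjugation in a completion commutes with powers, as this is a polynomial identity. -/
lemma conj_pow (hi : IsCompletionBasis R i x) (z y : N') (r : R) :
    z * y ^ r * z⁻¹ = (z * y * z⁻¹) ^ r := by
  obtain ⟨a, rfl⟩ := hi.bijective.2 z
  obtain ⟨b, rfl⟩ := hi.bijective.2 y
  have ha := isRatMap_coord (R := R) (i := i) (x := x)
    (Sum.inl : Fin h → Fin h ⊕ Fin h ⊕ Unit)
  have hb := isRatMap_coord (R := R) (i := i) (x := x)
    (fun k : Fin h => (Sum.inr (Sum.inl k) : Fin h ⊕ Fin h ⊕ Unit))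
  have hr := isRatPolynomial_coord (R := R) (Sum.inr (Sum.inr ()) : Fin h ⊕ Fin h ⊕ Unit)
  refine isRatMap_funext hi.bijective.1
    (hi.isRatMap_mul (hi.isRatMap_mul ha (hi.isRatMap_pow hb hr)) (hi.isRatMap_inv ha))
    (hi.isRatMap_pow (hi.isRatMap_mul (hi.isRatMap_mul ha hb) (hi.isRatMap_inv ha)) hr)
    (fun v => ?_) (Sum.elim a (Sum.elim b fun _ => r))
  simp only [hi.pow_intCast, conj_zpow]

variable {N₂ : Type*} {N₂' : Type*} [Group N₂] [Group N₂'] [Pow N₂' R] {i₂ : N₂ →* N₂'} {m : ℕ}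
  {x₂ : Fin m → N₂}

/-- A homomorphism extends to the completions by the formula
`x₁ ^ a₁ ⋯ x_h ^ a_h ↦ α(x₁) ^ a₁ ⋯ α(x_h) ^ a_h`; that this is an `R`-morphism is a system of
polynomial identities in the coordinates, which hold at integral points. -/
lemma exists_extension (hi : IsCompletionBasis R i x) (hi₂ : IsCompletionBasis R i₂ x₂)
    (α : N →* N₂) : ∃ φ : N' →* N₂', IsRMorphism R φ ∧ φ.comp i = i₂.comp α := by
  let e : (Fin h → R) ≃ N' := Equiv.ofBijective _ hi.bijective
  let A : (Fin h → R) → N₂' := coordProd fun k => i₂ (α (x k))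
  let φ : N' → N₂' := fun y => A (e.symm y)
  have he : ∀ a : Fin h → R, φ (coordProd (fun k => i (x k)) a) = A a := fun a =>
    congrArg A (e.symm_apply_apply a)
  have hφi : ∀ n, φ (i n) = i₂ (α n) := by
    intro n
    obtain ⟨a, rfl⟩ := hi.basis.coordProd_surjective n
    rw [← coordProd_intCast i hi.pow_intCast, he]
    exact coordProd_intCast (i₂.comp α) hi₂.pow_intCast x a
  have hφF : ∀ {ι : Type} {F : (ι → R) → N'}, IsRatMap (fun k => i (x k)) F →
      IsRatMap (fun k => i₂ (x₂ k)) fun v => φ (F v) := by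
    rintro ι F ⟨c, hc, hF⟩
    simp only [hF, he]
    exact hi₂.isRatMap_coordProd (fun k => α (x k)) hc
  have hmul : ∀ y z, φ (y * z) = φ y * φ z := by
    intro y z
    obtain ⟨a, rfl⟩ := hi.bijective.2 y
    obtain ⟨b, rfl⟩ := hi.bijective.2 z
    have ha := isRatMap_coord (R := R) (i := i) (x := x) (Sum.inl : Fin h → Fin h ⊕ Fin h)
    have hb := isRatMap_coord (R := R) (i := i) (x := x) (Sum.inr : Fin h → Fin h ⊕ Fin h)
    refine isRatMap_funext hi₂.bijective.1 (hφF (hi.isRatMap_mul ha hb))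
      (hi₂.isRatMap_mul (hφF ha) (hφF hb)) (fun v => ?_) (Sum.elim a b)
    simp only [coordProd_intCast i hi.pow_intCast _ fun k => v (Sum.inl k),
      coordProd_intCast i hi.pow_intCast _ fun k => v (Sum.inr k), ← map_mul, hφi]
  have hpow : ∀ y (r : R), φ (y ^ r) = φ y ^ r := by
    intro y r
    obtain ⟨a, rfl⟩ := hi.bijective.2 y
    have ha := isRatMap_coord (R := R) (i := i) (x := x) (Sum.inl : Fin h → Fin h ⊕ Unit)
    have hr := isRatPolynomial_coord (R := R) (Sum.inr () : Fin h ⊕ Unit)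
    refine isRatMap_funext hi₂.bijective.1 (hφF (hi.isRatMap_pow ha hr))
      (hi₂.isRatMap_pow (hφF ha) hr) (fun v => ?_) (Sum.elim a fun _ => r)
    simp only [coordProd_intCast i hi.pow_intCast _ fun k => v (Sum.inl k), hi.pow_intCast,
      hi₂.pow_intCast, ← map_zpow, hφi]
  exact ⟨MonoidHom.mk' φ hmul, hpow, MonoidHom.ext hφi⟩

end IsCompletionBasis

namespace IsMalcevCompletion

variable {N N' N₂ N₂' : Type*} [Group N] [Group N'] [Pow N' R] [Group N₂] [Group N₂'] [Pow N₂' R]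
  {i : N →* N'} {i₂ : N₂ →* N₂'}

lemma hom_ext (hi : IsMalcevCompletion R i) {H : Type*} [Group H] [Pow H R] {φ ψ : N' →* H}
    (hφ : IsRMorphism R φ) (hψ : IsRMorphism R ψ) (h : φ.comp i = ψ.comp i) : φ = ψ := by
  obtain ⟨_, _, hx⟩ := hi.exists_isCompletionBasis
  exact hx.hom_ext hφ hψ h

variable [IsDomain R] [CharZero R]

lemma isRMorphism_conj (hi : IsMalcevCompletion R i) (z : N') :
    IsRMorphism R (MulAut.conj z).toMonoidHom := by
  obtain ⟨_, _, hx⟩ := hi.exists_isCompletionBasis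
  exact fun y r => hx.conj_pow z y r

lemma exists_extension (hi : IsMalcevCompletion R i) (hi₂ : IsMalcevCompletion R i₂)
    (α : N →* N₂) : ∃ φ : N' →* N₂', IsRMorphism R φ ∧ φ.comp i = i₂.comp α := by
  obtain ⟨_, _, hx⟩ := hi.exists_isCompletionBasis
  obtain ⟨_, _, hx₂⟩ := hi₂.exists_isCompletionBasis
  exact hx.exists_extension hx₂ α

end IsMalcevCompletion

end Extension

/-! ### Functoriality and uniqueness for extensions -/

section Functoriality

variable {R : Type v} [CommRing R]
variable {N G F N' G' F' : Type*} [Group N] [Group G] [Group F] [Group N'] [Group G'] [Group F']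
  {S : GroupExtension N G F} {S' : GroupExtension N' G' F'} (θ : SESHom S S')

lemma SESHom.mid_inl (n : N) : θ.mid (S.inl n) = S'.inl (θ.left n) :=
  DFunLike.congr_fun θ.inl_comm n

lemma SESHom.rightHom_mid (g : G) : S'.rightHom (θ.mid g) = θ.right (S.rightHom g) :=
  DFunLike.congr_fun θ.rightHom_comm g

lemma _root_.GroupExtension.exists_inl_of_rightHom_eq_one {g : G} (h : S.rightHom g = 1) :
    ∃ n, S.inl n = g := by
  have h1 : g ∈ S.rightHom.ker := h
  rwa [← S.range_inl_eq_ker_rightHom] at h1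

/-- If the third component of a morphism is onto, then the middle group of the target is generated
by its kernel and the image of the middle component. -/
lemma SESHom.exists_eq_inl_mul_mid (h : Function.Surjective θ.right) (y : G') :
    ∃ n g, S'.inl n * θ.mid g = y := by
  obtain ⟨f, hf⟩ := h (S'.rightHom y)
  obtain ⟨g, rfl⟩ := S.rightHom_surjective f
  obtain ⟨n, hn⟩ := S'.exists_inl_of_rightHom_eq_one (g := y * (θ.mid g)⁻¹) (by
    rw [map_mul, map_inv, θ.rightHom_mid, hf, mul_inv_cancel])
  exact ⟨n, g, by rw [hn, inv_mul_cancel_right]⟩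

lemma SESHom.exists_of_inl_eq_mid (h : Function.Injective θ.right) {n : N'} {g : G}
    (hng : S'.inl n = θ.mid g) : ∃ m, S.inl m = g ∧ θ.left m = n := by
  obtain ⟨m, rfl⟩ := S.exists_inl_of_rightHom_eq_one (g := g) (h (by
    rw [← θ.rightHom_mid, ← hng, S'.rightHom_inl, map_one]))
  exact ⟨m, rfl, S'.inl_injective (by rw [hng, θ.mid_inl])⟩

lemma SESHom.left_conjAct (g : G) (n : N) :
    θ.left (S.conjAct g n) = S'.conjAct (θ.mid g) (θ.left n) := by
  apply S'.inl_injective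
  rw [← θ.mid_inl, S.inl_conjAct_comm, S'.inl_conjAct_comm, map_mul, map_mul, map_inv, θ.mid_inl]

lemma _root_.GroupExtension.inl_mul_mul_inl_mul (a b : N) (g h : G) :
    S.inl a * g * (S.inl b * h) = S.inl (a * S.conjAct g b) * (g * h) := by
  rw [map_mul, S.inl_conjAct_comm]
  group

variable {N₂ G₂ F₂ N₂' G₂' F₂' : Type*} [Group N₂] [Group G₂] [Group F₂] [Group N₂'] [Group G₂']
  [Group F₂'] {S₂ : GroupExtension N₂ G₂ F₂} {S₂' : GroupExtension N₂' G₂' F₂'} {θ}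
  {θ₂ : SESHom S₂ S₂'}

/-- A morphism of extensions whose first component extends to `N'`, compatibly with conjugation by
elements of `G`, extends to `S'`: on `G'`, which is `N'` amalgamated with `G` along `N`, it is
`n g ↦ α'(n) β(g)`. -/
lemma SESHom.exists_extension (hθ : Function.Bijective θ.right) (φ : SESHom S S₂) (α' : N' →* N₂')
    (hα' : α'.comp θ.left = θ₂.left.comp φ.left)
    (hconj : ∀ g n, α' (S'.conjAct (θ.mid g) n) = S₂'.conjAct (θ₂.mid (φ.mid g)) (α' n)) :
    ∃ ψ : SESHom S' S₂', ψ.left = α' ∧ ψ.comp θ = θ₂.comp φ := by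
  have hα : ∀ n, α' (θ.left n) = θ₂.left (φ.left n) := DFunLike.congr_fun hα'
  choose nn gg hng using θ.exists_eq_inl_mul_mid hθ.2
  let B : G' → G₂' := fun y => S₂'.inl (α' (nn y)) * θ₂.mid (φ.mid (gg y))
  have hB : ∀ n g, B (S'.inl n * θ.mid g) = S₂'.inl (α' n) * θ₂.mid (φ.mid g) := by
    intro n g
    have h1 := hng (S'.inl n * θ.mid g)
    simp only [B]
    generalize nn (S'.inl n * θ.mid g) = a at h1 ⊢
    generalize gg (S'.inl n * θ.mid g) = b at h1 ⊢
    obtain ⟨m, hm, hm'⟩ := θ.exists_of_inl_eq_mid hθ.1 (n := n⁻¹ * a) (g := g * b⁻¹) (by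
      rw [map_mul, map_inv, map_mul, map_inv, inv_mul_eq_iff_eq_mul, ← mul_assoc, ← h1,
        mul_inv_cancel_right])
    have ha : a = n * θ.left m := by rw [hm', mul_inv_cancel_left]
    have hg : g = S.inl m * b := by rw [hm, inv_mul_cancel_right]
    rw [ha, hg, map_mul α', hα, map_mul S₂'.inl, map_mul φ.mid, map_mul θ₂.mid, φ.mid_inl,
      θ₂.mid_inl, mul_assoc]
  have hBmul : ∀ y z, B (y * z) = B y * B z := by
    intro y z
    obtain ⟨a, g, rfl⟩ := θ.exists_eq_inl_mul_mid hθ.2 y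
    obtain ⟨b, g', rfl⟩ := θ.exists_eq_inl_mul_mid hθ.2 z
    rw [S'.inl_mul_mul_inl_mul, ← map_mul θ.mid, hB, hB, hB, S₂'.inl_mul_mul_inl_mul, map_mul α',
      hconj, map_mul φ.mid, map_mul θ₂.mid]
  have hBinl : ∀ n, B (S'.inl n) = S₂'.inl (α' n) := fun n => by
    simpa using hB n 1
  have hBmid : ∀ g, B (θ.mid g) = θ₂.mid (φ.mid g) := fun g => by
    simpa using hB 1 g
  let k := MulEquiv.ofBijective θ.right hθ
  have hk : ∀ f, k.symm (θ.right f) = f := fun f => k.symm_apply_apply f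
  let ψ : SESHom S' S₂' :=
    { left := α'
      mid := MonoidHom.mk' B hBmul
      right := (θ₂.right.comp φ.right).comp k.symm.toMonoidHom
      inl_comm := MonoidHom.ext hBinl
      rightHom_comm := by
        ext y
        obtain ⟨a, g, rfl⟩ := θ.exists_eq_inl_mul_mid hθ.2 y
        have h1 : S₂'.rightHom (B (S'.inl a * θ.mid g)) =
            θ₂.right (φ.right (k.symm (S'.rightHom (S'.inl a * θ.mid g)))) := by
          rw [hB, map_mul, map_mul, S₂'.rightHom_inl, S'.rightHom_inl, one_mul, one_mul,
            θ.rightHom_mid, θ₂.rightHom_mid, φ.rightHom_mid, hk]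
        exact h1 }
  refine ⟨ψ, rfl, SESHom.ext hα' (MonoidHom.ext hBmid) (MonoidHom.ext fun f => ?_)⟩
  change θ₂.right (φ.right (k.symm (θ.right f))) = _
  rw [hk]
  rfl

/-- A morphism out of `S'` is determined by its first component and its restriction to `S`. -/
lemma SESHom.ext_of_comp (hθ : Function.Surjective θ.right) {ψ ψ' : SESHom S' S₂'}
    (hl : ψ.left = ψ'.left) (h : ψ.comp θ = ψ'.comp θ) : ψ = ψ' := by
  have hm : ∀ g, ψ.mid (θ.mid g) = ψ'.mid (θ.mid g) :=
    DFunLike.congr_fun (congrArg SESHom.mid h)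
  have hr : ∀ f, ψ.right (θ.right f) = ψ'.right (θ.right f) :=
    DFunLike.congr_fun (congrArg SESHom.right h)
  refine SESHom.ext hl (MonoidHom.ext fun y => ?_) (MonoidHom.ext fun y => ?_)
  · obtain ⟨n, g, rfl⟩ := θ.exists_eq_inl_mul_mid hθ y
    rw [map_mul, map_mul, hm, ψ.mid_inl, ψ'.mid_inl, hl]
  · obtain ⟨f, rfl⟩ := hθ y
    exact hr f

variable [Pow N' R] [Pow N₂' R]

lemma IsSESMalcevCompletion.ext_of_comp (hθ : IsSESMalcevCompletion R θ) {ψ ψ' : SESHom S' S₂'}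
    (hψ : IsRMorphism R ψ.left) (hψ' : IsRMorphism R ψ'.left) (h : ψ.comp θ = ψ'.comp θ) :
    ψ = ψ' :=
  SESHom.ext_of_comp hθ.right.2 (hθ.left.hom_ext hψ hψ' (congrArg SESHom.left h)) h

theorem IsSESMalcevCompletion.existsUnique_extension [IsDomain R] [CharZero R]
    (hθ : IsSESMalcevCompletion R θ) (hθ₂ : IsSESMalcevCompletion R θ₂) (φ : SESHom S S₂) :
    ∃! ψ : SESHom S' S₂', IsRMorphism R ψ.left ∧ ψ.comp θ = θ₂.comp φ := by
  obtain ⟨α', hα', hα'i⟩ := hθ.left.exists_extension hθ₂.left φ.left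
  have hα : ∀ n, α' (θ.left n) = θ₂.left (φ.left n) := DFunLike.congr_fun hα'i
  obtain ⟨ψ, hψl, hψ⟩ := SESHom.exists_extension hθ.right φ α' hα'i fun g n => by
    -- both sides are `R`-morphisms in `n`, so it is enough to compare them on `N`
    have h1 : α'.comp (S'.conjAct (θ.mid g)).toMonoidHom =
        (S₂'.conjAct (θ₂.mid (φ.mid g))).toMonoidHom.comp α' := by
      refine hθ.left.hom_ext (fun y r => ?_) (fun y r => ?_) (MonoidHom.ext fun m => ?_)
      · exact (congrArg α' (hθ.conj (θ.mid g) y r)).trans (hα' _ r)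
      · exact (congrArg _ (hα' y r)).trans (hθ₂.conj (θ₂.mid (φ.mid g)) _ r)
      · change α' (S'.conjAct (θ.mid g) (θ.left m)) =
          S₂'.conjAct (θ₂.mid (φ.mid g)) (α' (θ.left m))
        rw [← θ.left_conjAct, hα, hα, φ.left_conjAct, θ₂.left_conjAct]
    exact DFunLike.congr_fun h1 n
  have hψr : IsRMorphism R ψ.left := by rw [hψl]; exact hα'
  exact ⟨ψ, ⟨hψr, hψ⟩, fun ψ' h => hθ.ext_of_comp h.1 hψr (h.2.trans hψ.symm)⟩

/-- The identity morphism of a short exact sequence. -/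
def SESHom.id (S : GroupExtension N G F) : SESHom S S where
  left := MonoidHom.id N
  mid := MonoidHom.id G
  right := MonoidHom.id F
  inl_comm := rfl
  rightHom_comm := rfl

theorem IsSESMalcevCompletion.existsUnique_iso [IsDomain R] [CharZero R]
    {θ₂ : SESHom S S₂'} (hθ : IsSESMalcevCompletion R θ) (hθ₂ : IsSESMalcevCompletion R θ₂) :
    ∃! ψ : SESHom S' S₂', ψ.IsIso ∧ IsRMorphism R ψ.left ∧ ψ.comp θ = θ₂ := by
  obtain ⟨ψ, ⟨hψr, hψ⟩, hu⟩ := hθ.existsUnique_extension hθ₂ (SESHom.id S)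
  obtain ⟨ψ', ⟨hψ'r, hψ'⟩, -⟩ := hθ₂.existsUnique_extension hθ (SESHom.id S)
  have hψ : ψ.comp θ = θ₂ := hψ
  have hψ' : ψ'.comp θ₂ = θ := hψ'
  have h1 : ψ'.comp ψ = SESHom.id S' := by
    refine hθ.ext_of_comp (fun y r => ?_) (fun _ _ => rfl) ?_
    · exact (congrArg ψ'.left (hψr y r)).trans (hψ'r _ r)
    · exact (congrArg ψ'.comp hψ).trans hψ'
  have h2 : ψ.comp ψ' = SESHom.id S₂' := by
    refine hθ₂.ext_of_comp (fun y r => ?_) (fun _ _ => rfl) ?_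
    · exact (congrArg ψ.left (hψ'r y r)).trans (hψr _ r)
    · exact (congrArg ψ.comp hψ').trans hψ
  refine ⟨ψ, ⟨⟨?_, ?_, ?_⟩, hψr, hψ⟩, fun χ hχ => hu χ ⟨hχ.2.1, hχ.2.2⟩⟩
  · exact Function.bijective_iff_has_inverse.2 ⟨ψ'.left,
      DFunLike.congr_fun (congrArg SESHom.left h1), DFunLike.congr_fun (congrArg SESHom.left h2)⟩
  · exact Function.bijective_iff_has_inverse.2 ⟨ψ'.mid,
      DFunLike.congr_fun (congrArg SESHom.mid h1), DFunLike.congr_fun (congrArg SESHom.mid h2)⟩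
  · exact Function.bijective_iff_has_inverse.2 ⟨ψ'.right,
      DFunLike.congr_fun (congrArg SESHom.right h1), DFunLike.congr_fun (congrArg SESHom.right h2)⟩

end Functoriality

/-! ### Existence for extensions -/

section Pushout

variable {N F : Type*} {G : Type uG} {N' : Type u} [Group N] [Group G] [Group F] [Group N']
  (S : GroupExtension N G F) (i : N →* N') (ρ : G →* MulAut N')

/-- For an extension `S` of `F` by `N`, a homomorphism `i : N →* N'` and an action `ρ` of `G` on
`N'`, compatible with the conjugation actions of `G` on `N` and of `N'` on itself: the normal
subgroup `{(i(m)⁻¹, m)}` of `N' ⋊ G` by which the copies of `N` in the two factors are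
identified. -/
def antidiagonal (h1 : ∀ g n, ρ g (i n) = i (S.conjAct g n)) : Subgroup (N' ⋊[ρ] G) where
  carrier := {p | ∃ m, p = ⟨(i m)⁻¹, S.inl m⟩}
  one_mem' := ⟨1, by ext <;> simp⟩
  mul_mem' := by
    rintro _ _ ⟨m, rfl⟩ ⟨n, rfl⟩
    refine ⟨m * n, ?_⟩
    have h2 : S.conjAct (S.inl m) n = m * n * m⁻¹ := S.inl_injective (by
      rw [S.inl_conjAct_comm, map_mul, map_mul, map_inv])
    ext
    · simp only [SemidirectProduct.mul_left, map_inv, h1, h2, map_mul]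
      group
    · simp
  inv_mem' := by
    rintro _ ⟨m, rfl⟩
    refine ⟨m⁻¹, ?_⟩
    have h2 : S.conjAct (S.inl m)⁻¹ m = m := S.inl_injective (by
      rw [S.inl_conjAct_comm, inv_mul_cancel, one_mul, inv_inv])
    ext
    · rw [SemidirectProduct.inv_left, inv_inv, h1, h2, map_inv, inv_inv]
    · simp

variable {S i ρ}

lemma antidiagonal_normal (h1 : ∀ g n, ρ g (i n) = i (S.conjAct g n))
    (h2 : ∀ n y, ρ (S.inl n) y = i n * y * (i n)⁻¹) : (antidiagonal S i ρ h1).Normal := by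
  refine ⟨?_⟩
  rintro _ ⟨m, rfl⟩ ⟨y, g⟩
  refine ⟨S.conjAct g m, ?_⟩
  have h3 : (⟨y, g⟩ : N' ⋊[ρ] G)⁻¹ = ⟨ρ g⁻¹ y⁻¹, g⁻¹⟩ := by ext <;> simp
  rw [h3]
  ext
  · have h4 : g * S.inl m * g⁻¹ = S.inl (S.conjAct g m) := S.inl_conjAct_comm.symm
    simp only [SemidirectProduct.mul_left, SemidirectProduct.mul_right]
    rw [← MulAut.mul_apply, ← map_mul, h4, h2, map_inv, h1]
    group
  · simp [S.inl_conjAct_comm]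

/-- The pushout of an extension along an equivariant homomorphism of kernels: the quotient of
the semidirect product `N' ⋊ G` by the antidiagonal copy of `N`. -/
lemma exists_pushout (h1 : ∀ g n, ρ g (i n) = i (S.conjAct g n))
    (h2 : ∀ n y, ρ (S.inl n) y = i n * y * (i n)⁻¹) :
    ∃ (G' : Type (max u uG)) (_ : Group G') (S' : GroupExtension N' G' F) (θ : SESHom S S'),
      θ.left = i ∧ θ.right = MonoidHom.id F ∧ ∀ g y, S'.conjAct (θ.mid g) y = ρ g y := by
  have hK := antidiagonal_normal h1 h2
  set K := antidiagonal S i ρ h1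
  let π : N' ⋊[ρ] G →* (N' ⋊[ρ] G) ⧸ K := QuotientGroup.mk' K
  let p : (N' ⋊[ρ] G) ⧸ K →* F := QuotientGroup.lift K (S.rightHom.comp SemidirectProduct.rightHom)
    (by
      rintro _ ⟨m, rfl⟩
      exact S.rightHom_inl m)
  have hπ : ∀ n, π (SemidirectProduct.inl (i n)) = π (SemidirectProduct.inr (S.inl n)) := by
    intro n
    refine QuotientGroup.eq.2 ⟨n, ?_⟩
    ext <;> simp
  let S' : GroupExtension N' ((N' ⋊[ρ] G) ⧸ K) F :=
    { inl := π.comp SemidirectProduct.inl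
      rightHom := p
      inl_injective := by
        rw [injective_iff_map_eq_one]
        intro y hy
        obtain ⟨m, hm⟩ := (QuotientGroup.eq_one_iff (N := K) _).1 hy
        have hm1 : (1 : G) = S.inl m := congrArg SemidirectProduct.right hm
        have hm2 : y = (i m)⁻¹ := congrArg SemidirectProduct.left hm
        rw [← map_one S.inl] at hm1
        rw [hm2, ← S.inl_injective hm1, map_one, inv_one]
      range_inl_eq_ker_rightHom := by
        ext q
        constructor
        · rintro ⟨y, rfl⟩
          exact map_one S.rightHom
        · obtain ⟨⟨y, g⟩, rfl⟩ := QuotientGroup.mk'_surjective K q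
          intro hq
          obtain ⟨m, rfl⟩ := S.exists_inl_of_rightHom_eq_one (g := g) hq
          refine ⟨y * i m, ?_⟩
          change π _ = π _
          rw [map_mul, map_mul, hπ, ← map_mul, ← SemidirectProduct.mk_eq_inl_mul_inr]
      rightHom_surjective := fun f => by
        obtain ⟨g, rfl⟩ := S.rightHom_surjective f
        exact ⟨π (SemidirectProduct.inr g), rfl⟩ }
  let θ : SESHom S S' :=
    { left := i
      mid := π.comp SemidirectProduct.inr
      right := MonoidHom.id F
      inl_comm := MonoidHom.ext fun n => (hπ n).symm
      rightHom_comm := rfl }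
  refine ⟨_, inferInstance, S', θ, rfl, rfl, fun g y => S'.inl_injective ?_⟩
  rw [S'.inl_conjAct_comm]
  change π _ * π _ * (π _)⁻¹ = π _
  rw [SemidirectProduct.inl_aut, map_mul, map_mul, map_inv, map_inv]

end Pushout

section Existence

/-- An extension of `F` by `N'` may be replaced by an isomorphic one whose middle group lives in
the universe of `N' × F`. -/
lemma exists_shrink {N G : Type*} {F : Type uF} {N' : Type u} {G' : Type*} [Group N] [Group G]
    [Group F] [Group N'] [Group G'] {S : GroupExtension N G F} {S' : GroupExtension N' G' F}
    (θ : SESHom S S') :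
    ∃ (G'' : Type (max u uF)) (_ : Group G'') (S'' : GroupExtension N' G'' F) (e : G'' ≃* G')
      (θ' : SESHom S S''), θ'.left = θ.left ∧ θ'.right = θ.right ∧
      ∀ g, S''.conjAct g = S'.conjAct (e g) := by
  have hsmall : Small.{max u uF} G' := by
    obtain ⟨s, hs⟩ := S'.rightHom_surjective.hasRightInverse
    refine small_of_surjective (f := fun p : N' × F => S'.inl p.1 * s p.2) fun y => ?_
    obtain ⟨n, hn⟩ := S'.exists_inl_of_rightHom_eq_one (g := y * (s (S'.rightHom y))⁻¹) (by
      rw [map_mul, map_inv, hs, mul_inv_cancel])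
    exact ⟨(n, S'.rightHom y), by simp only [hn, inv_mul_cancel_right]⟩
  let e : Shrink.{max u uF} G' ≃* G' := Shrink.mulEquiv
  let S'' : GroupExtension N' (Shrink.{max u uF} G') F :=
    { inl := e.symm.toMonoidHom.comp S'.inl
      rightHom := S'.rightHom.comp e.toMonoidHom
      inl_injective := e.symm.injective.comp S'.inl_injective
      range_inl_eq_ker_rightHom := by
        ext y
        constructor
        · rintro ⟨n, rfl⟩
          simp [MonoidHom.mem_ker]
        · intro hy
          obtain ⟨n, hn⟩ := S'.exists_inl_of_rightHom_eq_one (g := e y) hy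
          exact ⟨n, (congrArg e.symm hn).trans (e.symm_apply_apply y)⟩
      rightHom_surjective := S'.rightHom_surjective.comp e.surjective }
  refine ⟨_, inferInstance, S'', e,
    { left := θ.left
      mid := e.symm.toMonoidHom.comp θ.mid
      right := θ.right
      inl_comm := MonoidHom.ext fun n => congrArg e.symm (θ.mid_inl n)
      rightHom_comm := MonoidHom.ext fun g =>
        (congrArg S'.rightHom (e.apply_symm_apply _)).trans (θ.rightHom_mid g) },
    rfl, rfl, fun g => MulEquiv.ext fun n => S'.inl_injective ?_⟩
  have h1 := congrArg e (S''.inl_conjAct_comm (e := g) (n := n))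
  have h2 : ∀ n, e (S''.inl n) = S'.inl n := fun n => e.apply_symm_apply _
  rwa [map_mul, map_mul, map_inv, h2, h2, ← S'.inl_conjAct_comm] at h1

variable {R : Type v} [CommRing R] [IsDomain R] [CharZero R]

/-- The action of `G` on `N` by conjugation extends to an action on a completion of `N` by
`R`-automorphisms. -/
lemma IsMalcevCompletion.exists_action {N G F N' : Type*} [Group N] [Group G] [Group F] [Group N']
    [Pow N' R] (S : GroupExtension N G F) {i : N →* N'} (hi : IsMalcevCompletion R i) :
    ∃ ρ : G →* MulAut N', (∀ g, IsRMorphism R (ρ g).toMonoidHom) ∧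
      (∀ g n, ρ g (i n) = i (S.conjAct g n)) ∧ ∀ n y, ρ (S.inl n) y = i n * y * (i n)⁻¹ := by
  choose φ hφ hφi using fun g => hi.exists_extension hi (S.conjAct g).toMonoidHom
  have hφi' : ∀ g n, φ g (i n) = i (S.conjAct g n) := fun g n => DFunLike.congr_fun (hφi g) n
  have h1 : φ 1 = MonoidHom.id N' := by
    refine hi.hom_ext (hφ 1) (fun _ _ => rfl) (MonoidHom.ext fun n => ?_)
    change φ 1 (i n) = i n
    rw [hφi', map_one, MulAut.one_apply]
  have hmul : ∀ g g', φ (g * g') = (φ g).comp (φ g') := by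
    intro g g'
    refine hi.hom_ext (hφ _) (fun y r => ?_) (MonoidHom.ext fun n => ?_)
    · exact (congrArg (φ g) (hφ g' y r)).trans (hφ g _ r)
    · change φ (g * g') (i n) = φ g (φ g' (i n))
      rw [hφi', hφi', hφi', map_mul, MulAut.mul_apply]
  let ρ : G →* MulAut N' := MonoidHom.mk'
    (fun g => (φ g).toMulEquiv (φ g⁻¹) (by rw [← hmul, inv_mul_cancel, h1])
      (by rw [← hmul, mul_inv_cancel, h1]))
    (fun g g' => MulEquiv.ext fun y => DFunLike.congr_fun (hmul g g') y)
  refine ⟨ρ, hφ, hφi', fun n y => ?_⟩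
  have h2 : φ (S.inl n) = (MulAut.conj (i n)).toMonoidHom := by
    refine hi.hom_ext (hφ _) (hi.isRMorphism_conj (i n)) (MonoidHom.ext fun m => ?_)
    change φ (S.inl n) (i m) = i n * i m * (i n)⁻¹
    have h3 : S.conjAct (S.inl n) m = n * m * n⁻¹ := S.inl_injective (by
      rw [S.inl_conjAct_comm, map_mul, map_mul, map_inv])
    rw [hφi', h3, map_mul, map_mul, map_inv]
  exact DFunLike.congr_fun h2 y

/-- A completion of the kernel extends to a completion of the extension. -/
theorem IsMalcevCompletion.exists_sesCompletion {N : Type*} {G : Type uG} {F : Type uF}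
    {N' : Type u} [Group N] [Group G] [Group F] [Group N'] [Pow N' R] (S : GroupExtension N G F)
    {i : N →* N'} (hi : IsMalcevCompletion R i) :
    ∃ (G' : Type (max u uF)) (_ : Group G') (S' : GroupExtension N' G' F) (θ : SESHom S S'),
      IsSESMalcevCompletion R θ := by
  obtain ⟨ρ, hρ, h1, h2⟩ := hi.exists_action S
  obtain ⟨G', _, S', θ, hl, hr, hc⟩ := exists_pushout h1 h2
  obtain ⟨G'', _, S'', e, θ', hl', hr', hc'⟩ := exists_shrink θ
  refine ⟨G'', _, S'', θ', ⟨?_, ?_, fun g y r => ?_⟩⟩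
  · rwa [hl', hl]
  · rw [hr', hr]
    exact Function.bijective_id
  · rw [hc']
    have hθ : Function.Surjective θ.right := by
      rw [hr]
      exact Function.surjective_id
    -- an element of `G'` acts as an inner automorphism of `N'` composed with some `ρ g₀`
    obtain ⟨n, g₀, hng⟩ := θ.exists_eq_inl_mul_mid hθ (e g)
    have h3 : ∀ y, S'.conjAct (e g) y = n * ρ g₀ y * n⁻¹ := fun y => S'.inl_injective (by
      rw [← hng, map_mul, MulAut.mul_apply, hc, S'.inl_conjAct_comm, map_mul, map_mul, map_inv])
    change S'.conjAct (e g) (y ^ r) = (S'.conjAct (e g) y) ^ r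
    rw [h3, h3]
    exact (congrArg (fun z => n * z * n⁻¹) (hρ g₀ y r)).trans (hi.isRMorphism_conj n _ r)

end Existence

end Malcev

theorem mainTheorem8
    (R : Type u) [CommRing R] [IsDomain R] [CharZero R] [BinomialRing R] :
    -- existence
    (∀ (N : Type uN) (G : Type uG) (F : Type uF) [Group N] [Group G] [Group F]
      (S : GroupExtension N G F), Malcev.IsVirtuallyTau S →
      ∃ (N' : Type u) (G' : Type (max u uF)) (F' : Type uF)
        (_ : Group N') (_ : Group G') (_ : Group F') (_ : Pow N' R)
        (S' : GroupExtension N' G' F') (θ : Malcev.SESHom S S'),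
        Malcev.IsSESMalcevCompletion R θ) ∧
    -- functoriality
    (∀ (N₁ : Type a₁) (G₁ : Type a₂) (F₁ : Type a₃) (N₂ : Type b₁) (G₂ : Type b₂) (F₂ : Type b₃)
      (N₁' : Type c₁) (G₁' : Type c₂) (F₁' : Type c₃)
      (N₂' : Type d₁) (G₂' : Type d₂) (F₂' : Type d₃)
      [Group N₁] [Group G₁] [Group F₁] [Group N₂] [Group G₂] [Group F₂]
      [Group N₁'] [Group G₁'] [Group F₁'] [Group N₂'] [Group G₂'] [Group F₂']
      [Pow N₁' R] [Pow N₂' R]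
      (S₁ : GroupExtension N₁ G₁ F₁) (S₂ : GroupExtension N₂ G₂ F₂)
      (S₁' : GroupExtension N₁' G₁' F₁') (S₂' : GroupExtension N₂' G₂' F₂')
      (θ₁ : Malcev.SESHom S₁ S₁') (θ₂ : Malcev.SESHom S₂ S₂') (φ : Malcev.SESHom S₁ S₂),
      Malcev.IsVirtuallyTau S₁ → Malcev.IsVirtuallyTau S₂ →
      Malcev.IsSESMalcevCompletion R θ₁ → Malcev.IsSESMalcevCompletion R θ₂ →
      ∃! ψ : Malcev.SESHom S₁' S₂',
        Malcev.IsRMorphism R ψ.left ∧ ψ.comp θ₁ = θ₂.comp φ) ∧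
    -- uniqueness
    (∀ (N : Type uN) (G : Type uG) (F : Type uF)
      (N₁' : Type c₁) (G₁' : Type c₂) (F₁' : Type c₃)
      (N₂' : Type d₁) (G₂' : Type d₂) (F₂' : Type d₃)
      [Group N] [Group G] [Group F]
      [Group N₁'] [Group G₁'] [Group F₁'] [Group N₂'] [Group G₂'] [Group F₂']
      [Pow N₁' R] [Pow N₂' R]
      (S : GroupExtension N G F)
      (S₁' : GroupExtension N₁' G₁' F₁') (S₂' : GroupExtension N₂' G₂' F₂')
      (θ₁ : Malcev.SESHom S S₁') (θ₂ : Malcev.SESHom S S₂'),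
      Malcev.IsVirtuallyTau S →
      Malcev.IsSESMalcevCompletion R θ₁ → Malcev.IsSESMalcevCompletion R θ₂ →
      ∃! ψ : Malcev.SESHom S₁' S₂',
        ψ.IsIso ∧ Malcev.IsRMorphism R ψ.left ∧ ψ.comp θ₁ = θ₂) := by
  refine ⟨?_, ?_, ?_⟩
  · intro N G F _ _ _ S hS
    obtain ⟨N', _, _, i, hi⟩ := hS.1.exists_isMalcevCompletion R
    obtain ⟨G', _, S', θ, hθ⟩ := hi.exists_sesCompletion S
    exact ⟨N', G', F, _, _, _, _, S', θ, hθ⟩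
  · intro N₁ G₁ F₁ N₂ G₂ F₂ N₁' G₁' F₁' N₂' G₂' F₂' _ _ _ _ _ _ _ _ _ _ _ _ _ _ S₁ S₂ S₁' S₂'
      θ₁ θ₂ φ _ _ h₁ h₂
    exact h₁.existsUnique_extension h₂ φ
  · intro N G F N₁' G₁' F₁' N₂' G₂' F₂' _ _ _ _ _ _ _ _ _ _ _ S S₁' S₂' θ₁ θ₂ _ h₁ h₂
    exact h₁.existsUnique_iso h₂
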